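/- \textbf{Lemma (Lower bounds).} Let $d\ge 1$ be an integer and $p\in(0,1)$. Let $\mathbb L^d=(\mathbb Z^d,\mathbb E^d)$ be the hypercubic lattice, in which two vertices are joined by an edge if and only if their Euclidean distance is $1$. Let each edge in $\mathbb E^d$ be open, independently of the others, with probability $p$; write $\mathbb P$ for the resulting product measure on $\Omega=\{0,1\}^{\mathbb E^d}$, and $\mathcal G^{(\omega)}$ for the graph with vertex set $\mathbb Z^d$ whose edges are the open edges of $\omega\in\Omega$. Let $D^{(\omega)}$ and $A^{(\omega)}$ be the degree operator (multiplication by the vertex degree) and the adjacency operator of $\mathcal G^{(\omega)}$ on the complex Hilbert space $\ell^2(\mathbb Z^d)$, and define the Neumann, Pseudo-Dirichlet and Dirichlet Laplacians $$\Delta_{\mathrm N}^{(\omega)}=D^{(\omega)}-A^{(\omega)},\qquad \Delta_{\tilde{\mathrm D}}^{(\omega)}=\bigl(2d-D^{(\omega)}\bigr)+\Delta_{\mathrm N}^{(\omega)},\qquad \Delta_{\mathrm D}^{(\omega)}=2\bigl(2d-D^{(\omega)}\bigr)+\Delta_{\mathrm N}^{(\omega)}.$$ For $\mathrm X\in\{\mathrm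 N,\tilde{\mathrm D},\mathrm D\}$ let $$N_{\mathrm X}(E)=\int_\Omega \bigl\langle\delta_0,\Theta\bigl(E-\Delta_{\mathrm X}^{(\omega)}\bigr)\delta_0\bigr\rangle\,\mathbb P(d\omega),\qquad E\in\mathbb R,$$ be the integrated density of states, where $\delta_0\in\ell^2(\mathbb Z^d)$ is the unit sequence concentrated at the origin and $\Theta$ is the right-continuous Heaviside function, so that $\Theta(E-\Delta_{\mathrm X}^{(\omega)})$ is the spectral projection of $\Delta_{\mathrm X}^{(\omega)}$ for $(-\infty,E]$. Then there are constants $\alpha_{\mathrm N}^-,\alpha_{\mathrm D}^-\in(0,\infty)$, depending only on $d$ and $p$, such that for every $E\in(0,4d]$ $$N_{\mathrm N}(E)-N_{\mathrm N}(0)\ \ge\ \exp\bigl(-\alpha_{\mathrm N}^-\,E^{-1/2}\bigr)\qquad\text{and}\qquad N_{\tilde{\mathrm D}}(E)\ \ge\ N_{\mathrm D}(E)\ \ge\ \exp\bigl(-\alpha_{\mathrm D}^-\,E^{-d/2}\bigr).$$ -/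

import Mathlib

open MeasureTheory ProbabilityTheory Filter Topology

noncomputable section

namespace BondPercolation

/-! ### Graph Laplacians -/

/-- The complex Hilbert space `ℓ²(V)`. -/
abbrev ell2 (V : Type*) : Type _ := lp (fun _ : V => ℂ) 2

/-- `δ_x`, the sequence concentrated at the point `x`. -/
def delta {V : Type*} [DecidableEq V] (x : V) : ell2 V := lp.single 2 x (1 : ℂ)

section Laplacians

variable {V : Type*} (G : SimpleGraph V) [G.LocallyFinite] {d : ℕ}

/-- `∑_{x ∈ s} |d(x) φ(x)|² ≤ (2d ‖φ‖)²` when all vertex degrees are at most `2d`. -/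
theorem sum_degree_le (hG : ∀ x, G.degree x ≤ 2 * d) (φ : ell2 V) (s : Finset V) :
    ∑ x ∈ s, ‖(G.degree x : ℂ) * φ x‖ ^ (2 : ENNReal).toReal
      ≤ ((2 * d : ℝ) * ‖φ‖) ^ (2 : ENNReal).toReal := by
  have h2 : 0 < (2 : ENNReal).toReal := by norm_num
  have hs := lp.sum_rpow_le_norm_rpow h2 φ s
  simp only [ENNReal.toReal_ofNat, Real.rpow_ofNat] at hs ⊢
  calc ∑ x ∈ s, ‖(G.degree x : ℂ) * φ x‖ ^ 2
      ≤ ∑ x ∈ s, (2 * d : ℝ) ^ 2 * ‖φ x‖ ^ 2 := by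
        refine Finset.sum_le_sum fun x _ => ?_
        rw [norm_mul, mul_pow, Complex.norm_natCast]
        have : (G.degree x : ℝ) ≤ 2 * d := by exact_mod_cast hG x
        gcongr
    _ = (2 * d : ℝ) ^ 2 * ∑ x ∈ s, ‖φ x‖ ^ 2 := by rw [Finset.mul_sum]
    _ ≤ (2 * d : ℝ) ^ 2 * ‖φ‖ ^ 2 := by gcongr
    _ = _ := by ring

/-- `∑_{x ∈ s} |∑_{y ∼ x} φ(y)|² ≤ (2d ‖φ‖)²` when all vertex degrees are at most `2d`. -/
theorem sum_adj_le (hG : ∀ x, G.degree x ≤ 2 * d) (φ : ell2 V) (s : Finset V) :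
    ∑ x ∈ s, ‖∑ y ∈ G.neighborFinset x, φ y‖ ^ (2 : ENNReal).toReal
      ≤ ((2 * d : ℝ) * ‖φ‖) ^ (2 : ENNReal).toReal := by
  classical
  have h2 : 0 < (2 : ENNReal).toReal := by norm_num
  have hs := lp.sum_rpow_le_norm_rpow h2 φ (s.biUnion (fun x => G.neighborFinset x))
  simp only [ENNReal.toReal_ofNat, Real.rpow_ofNat] at hs ⊢
  have hdeg : ∀ x, (G.degree x : ℝ) ≤ 2 * d := fun x => by exact_mod_cast hG x
  calc ∑ x ∈ s, ‖∑ y ∈ G.neighborFinset x, φ y‖ ^ 2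
      ≤ ∑ x ∈ s, (2 * d : ℝ) * ∑ y ∈ G.neighborFinset x, ‖φ y‖ ^ 2 := by
        refine Finset.sum_le_sum fun x _ => ?_
        have h1 : ‖∑ y ∈ G.neighborFinset x, φ y‖ ^ 2
            ≤ (∑ y ∈ G.neighborFinset x, ‖φ y‖) ^ 2 := by
          gcongr
          exact norm_sum_le _ _
        have h3 := sq_sum_le_card_mul_sum_sq (s := G.neighborFinset x) (f := fun y => ‖φ y‖)
        rw [SimpleGraph.card_neighborFinset_eq_degree] at h3
        refine h1.trans (h3.trans ?_)
        exact mul_le_mul_of_nonneg_right (hdeg x) (Finset.sum_nonneg fun _ _ => by positivity)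
    _ = (2 * d : ℝ) * ∑ x ∈ s, ∑ y ∈ G.neighborFinset x, ‖φ y‖ ^ 2 := by rw [Finset.mul_sum]
    _ = (2 * d : ℝ) * ∑ y ∈ s.biUnion (fun x => G.neighborFinset x),
          ∑ x ∈ s.filter (fun x => G.Adj x y), ‖φ y‖ ^ 2 := by
        congr 1
        refine Finset.sum_comm' fun x y => ?_
        simp only [SimpleGraph.mem_neighborFinset, Finset.mem_filter, Finset.mem_biUnion]
        exact ⟨fun h => ⟨h, x, h⟩, fun h => h.1⟩
    _ ≤ (2 * d : ℝ) * ∑ y ∈ s.biUnion (fun x => G.neighborFinset x), (2 * d : ℝ) * ‖φ y‖ ^ 2 := by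
        gcongr with y _
        rw [Finset.sum_const, nsmul_eq_mul]
        refine mul_le_mul_of_nonneg_right (le_trans ?_ (hdeg y)) (by positivity)
        rw [← SimpleGraph.card_neighborFinset_eq_degree]
        exact_mod_cast Finset.card_le_card fun x hx => by
          simpa [SimpleGraph.adj_comm] using (Finset.mem_filter.1 hx).2
    _ = (2 * d : ℝ) ^ 2 * ∑ y ∈ s.biUnion (fun x => G.neighborFinset x), ‖φ y‖ ^ 2 := by
        rw [← Finset.mul_sum]; ring
    _ ≤ (2 * d : ℝ) ^ 2 * ‖φ‖ ^ 2 := by gcongr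
    _ = _ := by ring

/-- The degree operator, `[D(G) φ](x) = d_G(x) φ(x)`, of a graph whose vertex degrees are at most
`2d`. -/
def degreeOp (hG : ∀ x, G.degree x ≤ 2 * d) : ell2 V →L[ℂ] ell2 V :=
  LinearMap.mkContinuous
    { toFun := fun φ => ⟨fun x => (G.degree x : ℂ) * φ x, memℓp_gen' (sum_degree_le G hG φ)⟩
      map_add' := fun φ ψ => by ext x; exact mul_add _ _ _
      map_smul' := fun c φ => by ext x; simp [mul_left_comm] }
    (2 * d) (fun φ => lp.norm_le_of_forall_sum_le (by norm_num) (by positivity)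
      (sum_degree_le G hG φ))

/-- The adjacency operator, `[A(G) φ](x) = ∑_{y ∼ x} φ(y)`, of a graph whose vertex degrees are at
most `2d`. -/
def adjacencyOp (hG : ∀ x, G.degree x ≤ 2 * d) : ell2 V →L[ℂ] ell2 V :=
  LinearMap.mkContinuous
    { toFun := fun φ => ⟨fun x => ∑ y ∈ G.neighborFinset x, φ y, memℓp_gen' (sum_adj_le G hG φ)⟩
      map_add' := fun φ ψ => by ext x; exact Finset.sum_add_distrib
      map_smul' := fun c φ => by ext x; simp [Finset.mul_sum] }
    (2 * d) (fun φ => lp.norm_le_of_forall_sum_le (by norm_num) (by positivity)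
      (sum_adj_le G hG φ))

@[simp] theorem degreeOp_apply (hG : ∀ x, G.degree x ≤ 2 * d) (φ : ell2 V) (x : V) :
    degreeOp G hG φ x = (G.degree x : ℂ) * φ x := rfl

@[simp] theorem adjacencyOp_apply (hG : ∀ x, G.degree x ≤ 2 * d) (φ : ell2 V) (x : V) :
    adjacencyOp G hG φ x = ∑ y ∈ G.neighborFinset x, φ y := rfl

/-- The three boundary conditions: Neumann, Pseudo-Dirichlet and Dirichlet. -/
inductive BoundaryCondition
  | neumann
  | pseudoDirichlet
  | dirichlet

/-- The Laplacians `Δ_N = D - A`, `Δ_D̃ = (2d - D) + Δ_N` and `Δ_D = 2 (2d - D) + Δ_N` of a graph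
whose vertex degrees are at most `2d`. -/
def laplacian (hG : ∀ x, G.degree x ≤ 2 * d) : BoundaryCondition → (ell2 V →L[ℂ] ell2 V)
  | .neumann => degreeOp G hG - adjacencyOp G hG
  | .pseudoDirichlet =>
      ((2 * d : ℂ) • ContinuousLinearMap.id ℂ (ell2 V) - degreeOp G hG)
        + (degreeOp G hG - adjacencyOp G hG)
  | .dirichlet =>
      (2 : ℂ) • ((2 * d : ℂ) • ContinuousLinearMap.id ℂ (ell2 V) - degreeOp G hG)
        + (degreeOp G hG - adjacencyOp G hG)

theorem isSelfAdjoint_degreeOp (hG : ∀ x, G.degree x ≤ 2 * d) :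
    IsSelfAdjoint (degreeOp G hG) := by
  rw [ContinuousLinearMap.isSelfAdjoint_iff_isSymmetric]
  intro φ ψ
  simp only [ContinuousLinearMap.coe_coe, lp.inner_eq_tsum, degreeOp_apply]
  refine tsum_congr fun x => ?_
  simp [mul_left_comm, mul_assoc]

theorem isSelfAdjoint_adjacencyOp (hG : ∀ x, G.degree x ≤ 2 * d) :
    IsSelfAdjoint (adjacencyOp G hG) := by
  classical
  rw [ContinuousLinearMap.isSelfAdjoint_iff', ContinuousLinearMap.ext_iff]
  -- matrix elements
  have key : ∀ x y : V, inner ℂ (delta x) (adjacencyOp G hG (delta y))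
      = if G.Adj x y then (1 : ℂ) else 0 := by
    intro x y
    simp only [delta, lp.inner_single_left, adjacencyOp_apply, lp.single_apply]
    simp [Pi.single_apply, SimpleGraph.mem_neighborFinset]
  intro φ
  have hφ := lp.hasSum_single (E := fun _ : V => ℂ) (p := 2) (by norm_num) φ
  have hcoe : ∀ (S : ell2 V →L[ℂ] ell2 V), HasSum (fun y => φ y • S (delta y)) (S φ) := by
    intro S
    have := hφ.mapL S
    convert this using 2 with y
    rw [← map_smul]
    congr 1
    ext z
    by_cases h : z = y
    · subst h; simp [delta]
    · simp [delta, lp.single_apply, h]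
  have hbasis : ∀ y, ContinuousLinearMap.adjoint (adjacencyOp G hG) (delta y)
      = adjacencyOp G hG (delta y) := by
    intro y
    ext x
    have e : ∀ ψ : ell2 V, inner ℂ (delta x) ψ = ψ x := by
      intro ψ; simp [delta, lp.inner_single_left]
    rw [← e, ← e, ContinuousLinearMap.adjoint_inner_right, ← inner_conj_symm, key, key]
    simp [SimpleGraph.adj_comm, apply_ite]
  refine (hcoe _).unique ?_
  simpa only [hbasis] using hcoe (adjacencyOp G hG)

theorem isSelfAdjoint_laplacian (hG : ∀ x, G.degree x ≤ 2 * d) (X : BoundaryCondition) :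
    IsSelfAdjoint (laplacian G hG X) := by
  have hD := isSelfAdjoint_degreeOp G hG
  have hA := isSelfAdjoint_adjacencyOp G hG
  have h1 : IsSelfAdjoint ((2 * d : ℂ) • ContinuousLinearMap.id ℂ (ell2 V)) := by
    refine IsSelfAdjoint.smul ?_ (IsSelfAdjoint.one _)
    simp [isSelfAdjoint_iff]
  cases X with
  | neumann => exact hD.sub hA
  | pseudoDirichlet => exact (h1.sub hD).add (hD.sub hA)
  | dirichlet =>
    refine IsSelfAdjoint.add (IsSelfAdjoint.smul ?_ (h1.sub hD)) (hD.sub hA)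
    simp

end Laplacians

/-! ### Spectral projections -/

section Spectral

variable {H : Type*} [NormedAddCommGroup H] [InnerProductSpace ℂ H] [CompleteSpace H]

/-- `Θ(E - T)` for a bounded self-adjoint operator `T`, where `Θ` is the right-continuous Heaviside
function, that is, the spectral projection of `T` for `]-∞, E]`.  As `Θ(E - ·)` is the indicator
function of the zero set of the continuous function `t ↦ max (t - E) 0`, it is the orthogonal
projection onto the kernel of `max (T - E) 0`. -/
def heavisideOp (T : H →L[ℂ] H) (E : ℝ) : H →L[ℂ] H :=
  (cfc (fun t : ℝ => max (t - E) 0) T : H →L[ℂ] H).ker.starProjection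

/-- Continuous functions decreasing pointwise to `t ↦ Θ(E - t)`. -/
def ramp (E : ℝ) (n : ℕ) (t : ℝ) : ℝ := 1 - max (t - E) 0 / max (t - E) (1 / (n + 1))

/-- `Θ(E - T)` is the value of the (strongly sequentially continuous) functional calculus at
`Θ(E - ·)`. -/
theorem tendsto_cfc_ramp (T : H →L[ℂ] H) (hT : IsSelfAdjoint T) (E : ℝ) (φ : H) :
    Tendsto (fun n => cfc (ramp E n) T φ) atTop (𝓝 (heavisideOp T E φ)) := by
  set g : ℝ → ℝ := fun t => max (t - E) 0 with hg
  set Q : H →L[ℂ] H := cfc g T with hQ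
  have hgc : Continuous g := by fun_prop
  have hpos : ∀ (n : ℕ) (t : ℝ), 0 < max (t - E) (1 / ((n : ℝ) + 1)) := fun n t =>
    lt_max_of_lt_right (by positivity)
  have hhc : ∀ n : ℕ, Continuous fun t => (max (t - E) (1 / ((n : ℝ) + 1)))⁻¹ := fun n =>
    Continuous.inv₀ (by fun_prop) fun t => (hpos n t).ne'
  have hrc : ∀ n, Continuous (ramp E n) := fun n => by
    unfold ramp
    simp only [div_eq_mul_inv _ (max _ _)]
    exact continuous_const.sub (Continuous.mul (by fun_prop) (hhc n))
  have hr01 : ∀ n t, 0 ≤ ramp E n t ∧ ramp E n t ≤ 1 := fun n t => by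
    have h1 : max (t - E) 0 / max (t - E) (1 / ((n : ℝ) + 1)) ≤ 1 :=
      (div_le_one (hpos n t)).2 (max_le_max le_rfl (by positivity))
    have h0 : 0 ≤ max (t - E) 0 / max (t - E) (1 / ((n : ℝ) + 1)) :=
      div_nonneg (le_max_right _ _) (hpos n t).le
    unfold ramp
    constructor <;> linarith
  have hnorm : ∀ n, ‖(cfc (ramp E n) T : H →L[ℂ] H)‖ ≤ 1 := fun n =>
    norm_cfc_le zero_le_one fun t _ => by
      rw [Real.norm_of_nonneg (hr01 n t).1]; exact (hr01 n t).2
  -- on the kernel of `Q`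
  have hker : ∀ ψ, Q ψ = 0 → ∀ n, cfc (ramp E n) T ψ = ψ := by
    intro ψ hψ n
    have : cfc (ramp E n) T
        = 1 - cfc (fun t => (max (t - E) (1 / ((n : ℝ) + 1)))⁻¹) T * Q := by
      rw [hQ, ← cfc_mul _ _ T (hhc n).continuousOn hgc.continuousOn, ← cfc_const_one ℝ T,
        ← cfc_sub (fun _ => (1 : ℝ)) (fun t => (max (t - E) (1 / ((n : ℝ) + 1)))⁻¹ * g t) T
          continuousOn_const ((hhc n).mul hgc).continuousOn]
      refine cfc_congr fun t _ => ?_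
      simp [ramp, hg, div_eq_inv_mul]
    rw [this]
    simp [hψ]
  -- on the range of `Q`
  have hran : ∀ ψ n, ‖cfc (ramp E n) T (Q ψ)‖ ≤ 1 / ((n : ℝ) + 1) * ‖ψ‖ := by
    intro ψ n
    have : ‖cfc (ramp E n) T * Q‖ ≤ 1 / ((n : ℝ) + 1) := by
      rw [hQ, ← cfc_mul _ _ T (hrc n).continuousOn hgc.continuousOn]
      refine norm_cfc_le (by positivity) fun t _ => ?_
      have hg0 : 0 ≤ g t := le_max_right _ _
      rw [Real.norm_of_nonneg (mul_nonneg (hr01 n t).1 hg0)]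
      rcases le_total (t - E) (1 / ((n : ℝ) + 1)) with h | h
      · calc ramp E n t * g t ≤ 1 * (1 / ((n : ℝ) + 1)) :=
              mul_le_mul (hr01 n t).2 (max_le h (by positivity)) hg0 zero_le_one
          _ = _ := one_mul _
      · have h0 : 0 < t - E := lt_of_lt_of_le (by positivity) h
        have : ramp E n t = 0 := by
          rw [ramp, max_eq_left h, max_eq_left h0.le, div_self h0.ne', sub_self]
        rw [this, zero_mul]
        positivity
    exact (cfc (ramp E n) T * Q).le_of_opNorm_le this ψ
  -- on the closure of the range of `Q`
  have hQsa : ContinuousLinearMap.adjoint Q = Q :=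
    ContinuousLinearMap.isSelfAdjoint_iff'.1 (cfc_predicate g T)
  have hperp : ∀ χ ∈ Q.kerᗮ,
      Tendsto (fun n => cfc (ramp E n) T χ) atTop (𝓝 0) := by
    intro χ hχ
    have hχ' : χ ∈ closure (Set.range Q) := by
      have h := ContinuousLinearMap.orthogonal_ker Q
      rw [hQsa] at h
      rw [h] at hχ
      exact hχ
    rw [Metric.tendsto_atTop]
    intro ε hε
    obtain ⟨_, ⟨ψ, rfl⟩, hψ⟩ := Metric.mem_closure_iff.1 hχ' (ε / 2) (by positivity)
    have hlim : Tendsto (fun n : ℕ => 1 / ((n : ℝ) + 1) * ‖ψ‖) atTop (𝓝 0) := by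
      simpa using tendsto_one_div_add_atTop_nhds_zero_nat.mul_const ‖ψ‖
    obtain ⟨N, hN⟩ := (hlim.eventually (gt_mem_nhds (half_pos hε))).exists_forall_of_atTop
    refine ⟨N, fun n hn => ?_⟩
    rw [dist_zero_right]
    calc ‖cfc (ramp E n) T χ‖
        = ‖cfc (ramp E n) T (χ - Q ψ) + cfc (ramp E n) T (Q ψ)‖ := by rw [map_sub]; simp
      _ ≤ ‖cfc (ramp E n) T (χ - Q ψ)‖ + ‖cfc (ramp E n) T (Q ψ)‖ := norm_add_le _ _
      _ ≤ 1 * ‖χ - Q ψ‖ + 1 / ((n : ℝ) + 1) * ‖ψ‖ :=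
          add_le_add (ContinuousLinearMap.le_of_opNorm_le _ (hnorm n) _) (hran ψ n)
      _ < ε / 2 + ε / 2 := by
          rw [one_mul, ← dist_eq_norm]
          exact add_lt_add hψ (hN n hn)
      _ = ε := add_halves ε
  have hdec : ∀ n, cfc (ramp E n) T φ
      = heavisideOp T E φ + cfc (ramp E n) T (φ - heavisideOp T E φ) := by
    intro n
    have hm : Q (heavisideOp T E φ) = 0 :=
      LinearMap.mem_ker.1 (Submodule.starProjection_apply_mem Q.ker φ)
    rw [map_sub, hker _ hm n]
    abel
  simp_rw [hdec]
  have hlim := (hperp (φ - heavisideOp T E φ)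
    (Submodule.sub_starProjection_mem_orthogonal φ)).const_add (heavisideOp T E φ)
  rwa [add_zero] at hlim

end Spectral

/-! ### Bond percolation on the hypercubic lattice -/

/-- The simple hypercubic lattice `𝕃^d`: two vertices of `ℤ^d` are adjacent when their Euclidean
distance (equivalently, its square) is `1`. -/
def lattice (d : ℕ) : SimpleGraph (Fin d → ℤ) where
  Adj x y := ∑ i, (x i - y i) ^ 2 = 1
  symm := ⟨fun x y h => by
    rw [← h]
    exact Finset.sum_congr rfl fun i _ => by ring⟩
  loopless := ⟨fun x h => by simp at h⟩

/-- The probability space `Ω = {0,1}^{𝔼^d}` with its product sigma-algebra. -/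
abbrev Config (d : ℕ) : Type := (lattice d).edgeSet → Bool

/-- The law under which the edges are independently open (`true`) with probability `p`. -/
def percLaw (d : ℕ) (p : unitInterval) : Measure (Config d) :=
  Measure.infinitePi fun _ => bernoulliMeasure true false p

/-- The bond-percolation graph `G^(ω)`: vertex set `ℤ^d` and the open edges. -/
def percGraph {d : ℕ} (ω : Config d) : SimpleGraph (Fin d → ℤ) :=
  SimpleGraph.fromEdgeSet {e | ∃ h : e ∈ (lattice d).edgeSet, ω ⟨e, h⟩ = true}

theorem percGraph_le {d : ℕ} (ω : Config d) : percGraph ω ≤ lattice d := by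
  intro x y h
  obtain ⟨⟨h, -⟩, -⟩ := (SimpleGraph.fromEdgeSet_adj _).1 h
  exact h

/-- The `2d` nearest neighbours of a vertex. -/
theorem lattice_neighborSet_subset {d : ℕ} (x : Fin d → ℤ) :
    (lattice d).neighborSet x ⊆ ((Finset.univ ×ˢ ({1, -1} : Finset ℤ)).image
      fun q : Fin d × ℤ => x + Pi.single q.1 q.2 : Finset (Fin d → ℤ)) := by
  intro y hy
  replace hy : ∑ i, (x i - y i) ^ 2 = 1 := hy
  obtain ⟨i, hi⟩ : ∃ i, x i ≠ y i := by
    by_contra! h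
    simp [h] at hy
  rw [← Finset.add_sum_erase _ _ (Finset.mem_univ i)] at hy
  have h1 : 0 < (x i - y i) ^ 2 := by have := sub_ne_zero.2 hi; positivity
  have h2 : 0 ≤ ∑ j ∈ Finset.univ.erase i, (x j - y j) ^ 2 :=
    Finset.sum_nonneg fun _ _ => sq_nonneg _
  have h3 : ∑ j ∈ Finset.univ.erase i, (x j - y j) ^ 2 = 0 := by omega
  have h4 : (x i - y i) ^ 2 = 1 := by omega
  have h5 : ∀ j, j ≠ i → y j = x j := fun j hj => by
    have := (Finset.sum_eq_zero_iff_of_nonneg fun _ _ => sq_nonneg _).1 h3 j (by simp [hj])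
    have := pow_eq_zero_iff (two_ne_zero) |>.1 this
    omega
  have h6 : y i - x i = 1 ∨ y i - x i = -1 := by
    rcases sq_eq_one_iff.1 h4 with h | h <;> omega
  simp only [Finset.coe_image, Set.mem_image, Finset.mem_coe, Finset.mem_product,
    Finset.mem_univ, true_and, Finset.mem_insert, Finset.mem_singleton]
  refine ⟨(i, y i - x i), h6, ?_⟩
  ext j
  by_cases h : j = i
  · subst h; simp
  · simp [h, h5 j h]

instance {d : ℕ} (ω : Config d) : (percGraph ω).LocallyFinite := fun x =>
  ((Finset.finite_toSet _).subset
    (fun _ h => lattice_neighborSet_subset x (percGraph_le ω h))).fintype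

theorem percGraph_degree_le {d : ℕ} (ω : Config d) (x : Fin d → ℤ) :
    (percGraph ω).degree x ≤ 2 * d := by
  rw [← SimpleGraph.card_neighborFinset_eq_degree]
  have hsub : (percGraph ω).neighborFinset x ⊆
      (Finset.univ ×ˢ ({1, -1} : Finset ℤ)).image
        fun q : Fin d × ℤ => x + Pi.single q.1 q.2 := fun y hy =>
    lattice_neighborSet_subset x (percGraph_le ω ((SimpleGraph.mem_neighborFinset _ _ _).1 hy))
  refine (Finset.card_le_card hsub).trans (Finset.card_image_le.trans ?_)
  simp [mul_comm]

/-- The Laplacian `Δ_X^(ω)` on the bond-percolation graph. -/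
def percLaplacian {d : ℕ} (X : BoundaryCondition) (ω : Config d) :
    ell2 (Fin d → ℤ) →L[ℂ] ell2 (Fin d → ℤ) :=
  laplacian (percGraph ω) (percGraph_degree_le ω) X

/-- The integrated density of states
`N_X(E) = ∫ ℙ(dω) ⟨δ₀, Θ(E - Δ_X^(ω)) δ₀⟩`. The inner product is real, being that of a vector with
its image under an orthogonal projection. -/
def ids (d : ℕ) (p : unitInterval) (X : BoundaryCondition) (E : ℝ) : ℝ :=
  ∫ ω, (inner ℂ (delta 0) (heavisideOp (percLaplacian X ω) E (delta 0))).re ∂(percLaw d p)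

end BondPercolation

end

/-!
For the lower bounds, consider the event that all edges inside a finite set `S ∋ 0` are open and all
edges leaving it are closed; it has probability at least `min p (1 - p) ^ (2d|S|)`. On this event a
lattice eigenfunction on `S` that is continued evenly (Neumann) or oddly (Dirichlet) across the
boundary yields an eigenvector of the percolation Laplacian, hence a vector in the range of the
relevant spectral projection that overlaps with `δ₀`. Chains of length `n ∼ E ^ (-1/2)` with a
cosine mode, respectively cubes of side `n ∼ E ^ (-1/2)` with a product of sine modes, have an
eigenvalue at most `E`; the overlap is only polynomially small in `n` and is absorbed into the
exponential.

For `N_D ≤ N_D̃` it does not suffice that `Δ_D̃ ≤ Δ_D`, since `Θ(E - ·)` is not operator monotone.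
But the quadratic forms show that the range `U` of `Θ(E - Δ_D)` meets the orthogonal complement of
the range `V` of `Θ(E - Δ_D̃)` only in `0`. So `P_V P_U` is injective on `U` and has kernel `Uᗮ`,
whereas its adjoint `P_U P_V` vanishes on `Vᗮ`. The diagonal matrix element at the origin, averaged
over `ω`, is a trace on translation-covariant operators, so the kernels of an operator and of its
adjoint have the same trace, which gives `tr Vᗮ ≤ tr Uᗮ`, that is, `tr U ≤ tr V`.
-/

noncomputable section

namespace BondPercolation

section HilbertSpace

open Polynomial

theorem exists_polynomial_tendstoUniformlyOn {a b : ℝ} {f : ℝ → ℝ}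
    (hf : ContinuousOn f (Set.Icc a b)) :
    ∃ q : ℕ → ℝ[X], TendstoUniformlyOn (fun n t => (q n).eval t) f atTop (Set.Icc a b) := by
  choose q hq using fun n : ℕ =>
    exists_polynomial_near_of_continuousOn a b f hf (1 / (n + 1)) (by positivity)
  refine ⟨q, Metric.tendstoUniformlyOn_iff.2 fun ε hε => ?_⟩
  filter_upwards [tendsto_one_div_add_atTop_nhds_zero_nat.eventually_lt_const hε] with n hn t ht
  rw [dist_comm, Real.dist_eq]
  exact (hq n t ht).trans hn

variable {H : Type*} [NormedAddCommGroup H] [InnerProductSpace ℂ H]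

theorem aeval_monomial_eq_smul (T : H →L[ℂ] H) (n : ℕ) (a : ℝ) :
    aeval T (monomial n a) = (a : ℂ) • T ^ n := by
  rw [aeval_monomial, ← Algebra.smul_def]
  rfl

theorem aeval_apply_of_apply_eq_smul {T : H →L[ℂ] H} {l : ℝ} {v : H} (hv : T v = (l : ℂ) • v)
    (q : ℝ[X]) : aeval T q v = ((q.eval l : ℝ) : ℂ) • v := by
  have hpow : ∀ n : ℕ, (T ^ n) v = ((l ^ n : ℝ) : ℂ) • v := by
    intro n
    induction n with
    | zero => simp
    | succ n ih => rw [pow_succ', mul_apply_eq_comp, ih, map_smul, hv, smul_smul, pow_succ,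
        Complex.ofReal_mul]
  induction q using Polynomial.induction_on' with
  | add q r hq hr => simp only [map_add, add_apply, hq, hr, eval_add, Complex.ofReal_add, add_smul]
  | monomial n a =>
    rw [aeval_monomial_eq_smul, smul_apply, hpow, smul_smul, eval_monomial, Complex.ofReal_mul]

theorem ker_starProjection_mul_starProjection {U V : Submodule ℂ H} [U.HasOrthogonalProjection]
    [V.HasOrthogonalProjection] (h : Disjoint U Vᗮ) :
    (V.starProjection * U.starProjection).ker = Uᗮ := by
  ext v
  rw [LinearMap.mem_ker, ContinuousLinearMap.coe_coe, mul_apply_eq_comp,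
    Submodule.starProjection_apply_eq_zero_iff, ← Submodule.starProjection_apply_eq_zero_iff U]
  exact ⟨Submodule.disjoint_def.1 h _ (Submodule.starProjection_apply_mem U v),
    fun hv => hv ▸ Submodule.zero_mem _⟩

variable [CompleteSpace H]

theorem spectrum_subset_Icc {T : H →L[ℂ] H} {C : ℝ} (hC : ‖T‖ ≤ C) :
    spectrum ℝ T ⊆ Set.Icc (-C) C := by
  intro t ht
  have h1 := spectrum.norm_le_norm_mul_of_mem ht
  have h2 : ‖T‖ * ‖(1 : H →L[ℂ] H)‖ ≤ ‖T‖ * 1 :=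
    mul_le_mul_of_nonneg_left ContinuousLinearMap.norm_id_le (norm_nonneg T)
  rw [Real.norm_eq_abs] at h1
  exact abs_le.1 (by linarith)

theorem tendsto_aeval_cfc_apply {ι : Type*} {l : Filter ι} {T : H →L[ℂ] H} (hT : IsSelfAdjoint T)
    {C : ℝ} (hC : ‖T‖ ≤ C) {q : ι → ℝ[X]} {f : ℝ → ℝ}
    (hq : TendstoUniformlyOn (fun n t => (q n).eval t) f l (Set.Icc (-C) C)) (v : H) :
    Tendsto (fun n => aeval T (q n) v) l (𝓝 (cfc f T v)) := by
  have h : Tendsto (fun n => aeval T (q n)) l (𝓝 (cfc f T)) := by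
    simp only [← fun n => cfc_polynomial (q n) T hT]
    exact tendsto_cfc_fun (hq.mono (spectrum_subset_Icc hC))
      (Eventually.of_forall fun n => (q n).continuous.continuousOn)
  exact ((ContinuousLinearMap.apply ℂ H v).continuous.tendsto _).comp h

theorem norm_cfc_le_of_norm_le {T : H →L[ℂ] H} {C : ℝ} (hC : ‖T‖ ≤ C) {f : ℝ → ℝ} {B : ℝ}
    (hB : ∀ t ∈ Set.Icc (-C) C, ‖f t‖ ≤ B) : ‖cfc f T‖ ≤ B := by
  have hC0 : 0 ≤ C := (norm_nonneg T).trans hC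
  have hB0 : 0 ≤ B := (norm_nonneg _).trans (hB C ⟨by linarith, le_rfl⟩)
  exact norm_cfc_le hB0 fun t ht => hB t (spectrum_subset_Icc hC ht)

theorem continuous_ramp (E : ℝ) (n : ℕ) : Continuous (ramp E n) :=
  continuous_const.sub <| Continuous.div (by fun_prop) (by fun_prop) fun _ =>
    (lt_max_of_lt_right (by positivity)).ne'

theorem norm_ramp_le_one (E : ℝ) (n : ℕ) (t : ℝ) : ‖ramp E n t‖ ≤ 1 := by
  have hpos : 0 < max (t - E) (1 / ((n : ℝ) + 1)) := lt_max_of_lt_right (by positivity)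
  have hle : max (t - E) 0 / max (t - E) (1 / ((n : ℝ) + 1)) ≤ 1 :=
    (div_le_one hpos).2 (max_le_max le_rfl (by positivity))
  have hnonneg : 0 ≤ max (t - E) 0 / max (t - E) (1 / ((n : ℝ) + 1)) := by positivity
  rw [ramp, Real.norm_eq_abs, abs_le]
  constructor <;> linarith

theorem cfc_apply_of_apply_eq_smul {T : H →L[ℂ] H} (hT : IsSelfAdjoint T) {f : ℝ → ℝ}
    (hf : Continuous f) {l : ℝ} {v : H} (hv : T v = (l : ℂ) • v) :
    cfc f T v = (f l : ℂ) • v := by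
  set C := max ‖T‖ |l|
  obtain ⟨q, hq⟩ := exists_polynomial_tendstoUniformlyOn (a := -C) (b := C) hf.continuousOn
  have hval : Tendsto (fun n => (((q n).eval l : ℝ) : ℂ) • v) atTop (𝓝 ((f l : ℂ) • v)) :=
    ((Complex.continuous_ofReal.tendsto _).comp
      (hq.tendsto_at (abs_le.1 (le_max_right _ _)))).smul_const v
  refine tendsto_nhds_unique (tendsto_aeval_cfc_apply hT (le_max_left _ _) hq v) ?_
  simpa only [aeval_apply_of_apply_eq_smul hv] using hval

theorem le_smul_one_of_norm_le {T : H →L[ℂ] H} (hT : IsSelfAdjoint T) {C : ℝ} (hC : ‖T‖ ≤ C) :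
    T ≤ (C : ℂ) • 1 := by
  have h : T ≤ algebraMap ℝ (H →L[ℂ] H) C :=
    hT.le_algebraMap_norm_self.trans (algebraMap_mono _ hC)
  rwa [Algebra.algebraMap_eq_smul_one] at h

theorem apply_eq_zero_of_re_inner_le_zero {T : H →L[ℂ] H} (hT : 0 ≤ T) {v : H}
    (hv : (inner ℂ (T v) v).re ≤ 0) : T v = 0 := by
  obtain ⟨S, rfl⟩ := CStarAlgebra.nonneg_iff_eq_star_mul_self.1 hT
  rw [mul_apply_eq_comp, ContinuousLinearMap.star_eq_adjoint,
    ContinuousLinearMap.adjoint_inner_left] at hv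
  have hS : S v = 0 := re_inner_self_nonpos (𝕜 := ℂ) |>.1 hv
  rw [mul_apply_eq_comp, hS, map_zero]

theorem ker_le_ker_of_nonneg_of_le {A B : H →L[ℂ] H} (hA : 0 ≤ A) (hAB : A ≤ B) :
    B.ker ≤ A.ker := by
  intro v hv
  have h := ((ContinuousLinearMap.le_def _ _).1 hAB).re_inner_nonneg_left v
  rw [sub_apply, show B v = 0 from hv, zero_sub, inner_neg_left, map_neg] at h
  exact apply_eq_zero_of_re_inner_le_zero hA (neg_nonneg.1 h)

theorem norm_inner_sq_le_of_isStarProjection {R : H →L[ℂ] H} (hR : IsStarProjection R) {v : H}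
    (hv : R v = v) (φ : H) :
    ‖(inner ℂ v φ : ℂ)‖ ^ 2 ≤ ‖v‖ ^ 2 * (inner ℂ φ (R φ)).re := by
  have hsymm := ContinuousLinearMap.isSelfAdjoint_iff_isSymmetric.1 hR.isSelfAdjoint
  have hidem : R (R φ) = R φ := DFunLike.congr_fun hR.isIdempotentElem φ
  have hv' : (inner ℂ v φ : ℂ) = inner ℂ v (R φ) := by
    rw [← show inner ℂ (R v) φ = inner ℂ v (R φ) from hsymm v φ, hv]
  have hφ : (inner ℂ φ (R φ)).re = ‖R φ‖ ^ 2 := by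
    rw [← hidem, ← show inner ℂ (R φ) (R φ) = inner ℂ φ (R (R φ)) from hsymm φ (R φ), hidem]
    exact inner_self_eq_norm_sq (𝕜 := ℂ) (R φ)
  rw [hv', hφ, ← mul_pow]
  gcongr
  exact norm_inner_le_norm _ _

end HilbertSpace

section SpectralSubspace

variable {H : Type*} [NormedAddCommGroup H] [InnerProductSpace ℂ H] [CompleteSpace H]

/-- The spectral subspace of `T` for `]-∞, E]`, that is, the range of `Θ(E - T)`. It is encoded as
the kernel of the positive part of `T - E`. -/
def spectralSubspace (T : H →L[ℂ] H) (E : ℝ) : Submodule ℂ H :=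
  (cfc (fun t : ℝ => max (t - E) 0) T : H →L[ℂ] H).ker

instance (T : H →L[ℂ] H) (E : ℝ) : (spectralSubspace T E).HasOrthogonalProjection :=
  inferInstanceAs ((cfc (fun t : ℝ => max (t - E) 0) T : H →L[ℂ] H).ker.HasOrthogonalProjection)

theorem heavisideOp_eq_starProjection (T : H →L[ℂ] H) (E : ℝ) :
    heavisideOp T E = (spectralSubspace T E).starProjection := rfl

theorem mem_spectralSubspace {T : H →L[ℂ] H} {E : ℝ} {v : H} :
    v ∈ spectralSubspace T E ↔ cfc (fun t : ℝ => max (t - E) 0) T v = 0 := Iff.rfl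

theorem isStarProjection_heavisideOp (T : H →L[ℂ] H) (E : ℝ) :
    IsStarProjection (heavisideOp T E) := isStarProjection_starProjection

theorem heavisideOp_apply_of_apply_eq_smul {T : H →L[ℂ] H} (hT : IsSelfAdjoint T) {E l : ℝ}
    (hl : l ≤ E) {v : H} (hv : T v = (l : ℂ) • v) : heavisideOp T E v = v := by
  refine Submodule.starProjection_eq_self_iff.2 (mem_spectralSubspace.2 ?_)
  rw [cfc_apply_of_apply_eq_smul hT (by fun_prop) hv, max_eq_right (by linarith),
    Complex.ofReal_zero, zero_smul]

theorem heavisideOp_apply_eq_zero_of_apply_eq_smul {T : H →L[ℂ] H} (hT : IsSelfAdjoint T)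
    {E l : ℝ} (hl : E < l) {v : H} (hv : T v = (l : ℂ) • v) : heavisideOp T E v = 0 := by
  rw [heavisideOp_eq_starProjection, Submodule.starProjection_apply_eq_zero_iff]
  set Q : H →L[ℂ] H := cfc (fun t : ℝ => max (t - E) 0) T
  have hQ : Q v = ((l - E : ℝ) : ℂ) • v := by
    rw [cfc_apply_of_apply_eq_smul hT (by fun_prop) hv, max_eq_left (by linarith)]
  have hQsymm := ContinuousLinearMap.isSelfAdjoint_iff_isSymmetric.1
    (cfc_predicate (fun t : ℝ => max (t - E) 0) T)
  intro w hw
  have h : inner ℂ (Q w) v = inner ℂ w (Q v) := hQsymm w v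
  rw [mem_spectralSubspace.1 hw, inner_zero_left, hQ, inner_smul_right, eq_comm, mul_eq_zero] at h
  exact h.resolve_left (Complex.ofReal_ne_zero.2 (by linarith))

theorem spectralSubspace_mono (T : H →L[ℂ] H) {E E' : ℝ} (h : E ≤ E') :
    spectralSubspace T E ≤ spectralSubspace T E' :=
  ker_le_ker_of_nonneg_of_le (cfc_nonneg fun _ _ => le_max_right _ _)
    (cfc_mono fun _ _ => max_le_max (by linarith) le_rfl)

theorem isStarProjection_heavisideOp_sub (T : H →L[ℂ] H) {E E' : ℝ} (h : E ≤ E') :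
    IsStarProjection (heavisideOp T E' - heavisideOp T E) :=
  (isStarProjection_heavisideOp T E).sub_of_mul_eq_right (isStarProjection_heavisideOp T E') <| by
    ext v
    exact Submodule.starProjection_eq_self_iff.2
      (spectralSubspace_mono T h (Submodule.starProjection_apply_mem _ v))

theorem sub_algebraMap_eq_cfc_sub_cfc {T : H →L[ℂ] H} (hT : IsSelfAdjoint T) (E : ℝ) :
    T - algebraMap ℝ _ E = cfc (fun t => max (t - E) 0) T - cfc (fun t => max (E - t) 0) T := by
  rw [← cfc_sub (fun t => max (t - E) 0) (fun t => max (E - t) 0) T]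
  have h : (fun t : ℝ => max (t - E) 0 - max (E - t) 0) = fun t => t - E := by
    funext t
    rw [← neg_sub t E]
    exact max_zero_sub_max_neg_zero_eq_self (t - E)
  rw [h, cfc_sub (fun t => t) (fun _ => E) T, cfc_const _ T hT, cfc_id' ℝ T]

theorem cfc_max_sub_apply_mem_spectralSubspace (T : H →L[ℂ] H) (E : ℝ) (v : H) :
    cfc (fun t => max (E - t) 0) T v ∈ spectralSubspace T E := by
  have h : (fun t : ℝ => max (t - E) 0 * max (E - t) 0) = fun _ => 0 := by
    funext t
    rcases le_total t E with ht | ht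
    · rw [max_eq_right (by linarith), zero_mul]
    · rw [max_eq_right (a := E - t) (by linarith), mul_zero]
  rw [mem_spectralSubspace, ← mul_apply_eq_comp, ← cfc_mul _ _ T, h, cfc_const_zero, zero_apply]

theorem re_inner_sub_algebraMap_nonpos_of_mem {T : H →L[ℂ] H} (hT : IsSelfAdjoint T) {E : ℝ} {v : H}
    (hv : v ∈ spectralSubspace T E) : (inner ℂ ((T - algebraMap ℝ _ E) v) v).re ≤ 0 := by
  have h0 : 0 ≤ cfc (fun t => max (E - t) 0) T := cfc_nonneg fun t _ => le_max_right _ _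
  rw [sub_algebraMap_eq_cfc_sub_cfc hT, sub_apply, mem_spectralSubspace.1 hv, zero_sub,
    inner_neg_left, Complex.neg_re, neg_nonpos]
  exact ((ContinuousLinearMap.nonneg_iff_isPositive _).1 h0).re_inner_nonneg_left v

theorem re_inner_sub_algebraMap_pos_of_mem_orthogonal {T : H →L[ℂ] H} (hT : IsSelfAdjoint T)
    {E : ℝ} {v : H} (hv : v ∈ (spectralSubspace T E)ᗮ) (hv0 : v ≠ 0) :
    0 < (inner ℂ ((T - algebraMap ℝ _ E) v) v).re := by
  have h0 : 0 ≤ cfc (fun t => max (t - E) 0) T := cfc_nonneg fun t _ => le_max_right _ _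
  rw [sub_algebraMap_eq_cfc_sub_cfc hT, sub_apply, inner_sub_left,
    hv _ (cfc_max_sub_apply_mem_spectralSubspace T E v), sub_zero]
  refine lt_of_not_ge fun h => hv0 ?_
  exact inner_self_eq_zero.1
    (hv v (mem_spectralSubspace.2 (apply_eq_zero_of_re_inner_le_zero h0 h)))

theorem disjoint_spectralSubspace_orthogonal {A B : H →L[ℂ] H} (hA : IsSelfAdjoint A)
    (hB : IsSelfAdjoint B) (hAB : A ≤ B) (E : ℝ) :
    Disjoint (spectralSubspace B E) (spectralSubspace A E)ᗮ := by
  rw [Submodule.disjoint_def]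
  intro v hvB hvA
  by_contra hv0
  have hle := ((ContinuousLinearMap.le_def _ _).1 hAB).re_inner_nonneg_left v
  rw [← sub_sub_sub_cancel_right B A (algebraMap ℝ _ E), sub_apply, inner_sub_left, map_sub] at hle
  exact (re_inner_sub_algebraMap_pos_of_mem_orthogonal hA hvA hv0).not_ge
    ((sub_nonneg.1 hle).trans (re_inner_sub_algebraMap_nonpos_of_mem hB hvB))

theorem heavisideOp_star_mul_self (T : H →L[ℂ] H) :
    heavisideOp (star T * T) 0 = T.ker.starProjection := by
  have hcfc : cfc (fun t : ℝ => max (t - 0) 0) (star T * T) = star T * T := by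
    conv_rhs => rw [← cfc_id' ℝ (star T * T)]
    refine cfc_congr fun t ht => ?_
    rw [sub_zero, max_eq_left (spectrum_nonneg_of_nonneg (star_mul_self_nonneg T) ht)]
  have hker : spectralSubspace (star T * T) 0 = T.ker := by
    rw [spectralSubspace, hcfc]
    exact T.ker_adjoint_comp_self
  rw [heavisideOp_eq_starProjection]
  simp only [hker]

end SpectralSubspace

section Ell2

variable {V : Type*}

theorem sum_sq_norm_le (φ : ell2 V) (s : Finset V) : ∑ x ∈ s, ‖φ x‖ ^ 2 ≤ ‖φ‖ ^ 2 := by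
  simpa using lp.sum_rpow_le_norm_rpow (p := 2) (by norm_num) φ s

theorem tendsto_coe_apply {ι : Type*} {l : Filter ι} {φ : ι → ell2 V} {ψ : ell2 V}
    (h : Tendsto φ l (𝓝 ψ)) (x : V) : Tendsto (fun i => φ i x) l (𝓝 (ψ x)) :=
  ((lp.lipschitzWith_one_eval (E := fun _ : V => ℂ) 2 x).continuous.tendsto ψ).comp h

variable [DecidableEq V]

theorem delta_apply (x y : V) : (delta x : ell2 V) y = if y = x then 1 else 0 := by
  simp [delta, lp.single_apply, Pi.single_apply]

theorem norm_delta (x : V) : ‖(delta x : ell2 V)‖ = 1 := by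
  simp [delta, lp.norm_single]

theorem inner_delta_left (x : V) (φ : ell2 V) : inner ℂ (delta x) φ = φ x := by
  simp [delta, lp.inner_single_left]

theorem inner_delta_right (x : V) (φ : ell2 V) :
    inner ℂ φ (delta x) = (starRingEnd ℂ) (φ x) := by
  rw [← inner_conj_symm, inner_delta_left]

theorem hasSum_mul_apply_delta (S : ell2 V →L[ℂ] ell2 V) (φ : ell2 V) (x : V) :
    HasSum (fun y => φ y * S (delta y) x) (S φ x) := by
  have hsingle : ∀ y, lp.single 2 y (φ y) = φ y • (delta y : ell2 V) := fun y => by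
    rw [delta, ← lp.single_smul, smul_eq_mul, mul_one]
  have h := ((lp.hasSum_single (E := fun _ : V => ℂ) (p := 2) (by norm_num) φ).mapL S).mapL
    (innerSL ℂ (delta x : ell2 V))
  simpa only [hsingle, map_smul, innerSL_apply_apply, inner_delta_left, smul_eq_mul] using h

theorem norm_apply_delta_le {T : ell2 V →L[ℂ] ell2 V} {C : ℝ} (hT : ‖T‖ ≤ C) (x : V) :
    ‖T (delta x)‖ ≤ C := by
  simpa [norm_delta] using T.le_of_opNorm_le hT (delta x)

theorem norm_apply_delta_apply_le {T : ell2 V →L[ℂ] ell2 V} {C : ℝ} (hT : ‖T‖ ≤ C) (x y : V) :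
    ‖T (delta y) x‖ ≤ C :=
  (lp.norm_apply_le_norm two_ne_zero _ x).trans (norm_apply_delta_le hT y)

theorem star_apply_delta_apply (T : ell2 V →L[ℂ] ell2 V) (x y : V) :
    star T (delta y) x = (starRingEnd ℂ) (T (delta x) y) := by
  rw [ContinuousLinearMap.star_eq_adjoint, ← inner_delta_left,
    ContinuousLinearMap.adjoint_inner_right, inner_delta_right]

theorem sum_norm_mul_le {S T : ell2 V →L[ℂ] ell2 V} {B C : ℝ} (hS : ‖S‖ ≤ B) (hT : ‖T‖ ≤ C)
    (x : V) (s : Finset V) :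
    ∑ z ∈ s, ‖T (delta x) z * S (delta z) x‖ ≤ C ^ 2 + B ^ 2 := by
  have hS' : ‖star S (delta x)‖ ≤ B := norm_apply_delta_le ((norm_star S).trans_le hS) x
  calc ∑ z ∈ s, ‖T (delta x) z * S (delta z) x‖
      ≤ ∑ z ∈ s, (‖T (delta x) z‖ ^ 2 + ‖star S (delta x) z‖ ^ 2) := by
        gcongr with z
        rw [norm_mul, star_apply_delta_apply, RCLike.norm_conj]
        nlinarith [sq_nonneg (‖T (delta x) z‖ - ‖S (delta z) x‖)]
    _ ≤ ‖T (delta x)‖ ^ 2 + ‖star S (delta x)‖ ^ 2 := by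
        rw [Finset.sum_add_distrib]
        exact add_le_add (sum_sq_norm_le _ _) (sum_sq_norm_le _ _)
    _ ≤ C ^ 2 + B ^ 2 := by
        gcongr
        exact norm_apply_delta_le hT x

end Ell2

/-- `lp` carries a real module structure of its own, with which instance search would build an
`ℝ`-algebra of operators that the functional calculus does not recognize. -/
instance {V : Type*} : Algebra ℝ (ell2 V →L[ℂ] ell2 V) := NormedAlgebra.complexToReal.toAlgebra

section Covariant

variable {Ω G : Type*} [MeasurableSpace Ω] [AddGroup G] [DecidableEq G] [VAdd G Ω]

/-- Uniformly bounded families `T` of operators on `ℓ²(G)`, indexed by a space `Ω` on which `G`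
acts, whose matrix elements are measurable and satisfy the covariance
`⟨δ_{g + x}, T (g +ᵥ ω) δ_{g + y}⟩ = ⟨δ_x, T ω δ_y⟩`. -/
structure IsCovariant (T : Ω → (ell2 G →L[ℂ] ell2 G)) : Prop where
  measurable : ∀ x y, Measurable fun ω => T ω (delta y) x
  apply_vadd : ∀ g x y ω, T (g +ᵥ ω) (delta (g + y)) (g + x) = T ω (delta y) x
  bounded : ∃ C, ∀ ω, ‖T ω‖ ≤ C

namespace IsCovariant

variable {S T : Ω → (ell2 G →L[ℂ] ell2 G)}

protected theorem one : IsCovariant (fun _ : Ω => (1 : ell2 G →L[ℂ] ell2 G)) where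
  measurable _ _ := measurable_const
  apply_vadd g x y _ := by simp only [one_apply_eq_self, delta_apply, add_right_inj]
  bounded := ⟨1, fun _ => ContinuousLinearMap.norm_id_le⟩

protected theorem smul (c : ℂ) (hT : IsCovariant T) : IsCovariant fun ω => c • T ω where
  measurable x y := (hT.measurable x y).const_mul c
  apply_vadd g x y ω := congrArg (c * ·) (hT.apply_vadd g x y ω)
  bounded := by
    obtain ⟨C, hC⟩ := hT.bounded
    exact ⟨‖c‖ * C, fun ω => (norm_smul_le c (T ω)).trans (by gcongr; exact hC ω)⟩

protected theorem add (hS : IsCovariant S) (hT : IsCovariant T) :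
    IsCovariant fun ω => S ω + T ω where
  measurable x y := (hS.measurable x y).add (hT.measurable x y)
  apply_vadd g x y ω := congrArg₂ (· + ·) (hS.apply_vadd g x y ω) (hT.apply_vadd g x y ω)
  bounded := by
    obtain ⟨B, hB⟩ := hS.bounded
    obtain ⟨C, hC⟩ := hT.bounded
    exact ⟨B + C, fun ω => (norm_add_le _ _).trans (add_le_add (hB ω) (hC ω))⟩

protected theorem sub (hS : IsCovariant S) (hT : IsCovariant T) :
    IsCovariant fun ω => S ω - T ω := by
  simpa only [neg_smul, one_smul, sub_eq_add_neg] using hS.add (hT.smul (-1))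

protected theorem star (hT : IsCovariant T) : IsCovariant fun ω => star (T ω) where
  measurable x y := by
    simp only [star_apply_delta_apply]
    exact Complex.continuous_conj.measurable.comp (hT.measurable y x)
  apply_vadd g x y ω := by
    simp only [star_apply_delta_apply, hT.apply_vadd]
  bounded := by
    obtain ⟨C, hC⟩ := hT.bounded
    exact ⟨C, fun ω => (norm_star (T ω)).trans_le (hC ω)⟩

protected theorem mul [Countable G] (hS : IsCovariant S) (hT : IsCovariant T) :
    IsCovariant fun ω => S ω * T ω where
  measurable x y := by
    refine measurable_of_tendsto_metrizable' (atTop : Filter (Finset G))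
      (f := fun s ω => ∑ z ∈ s, T ω (delta y) z * S ω (delta z) x) (fun s => ?_)
      (tendsto_pi_nhds.2 fun ω => hasSum_mul_apply_delta (S ω) (T ω (delta y)) x)
    exact Finset.measurable_sum _ fun z _ => (hT.measurable z y).mul (hS.measurable x z)
  apply_vadd g x y ω := by
    refine (hasSum_mul_apply_delta (S (g +ᵥ ω)) (T (g +ᵥ ω) (delta (g + y))) (g + x)).unique ?_
    rw [← (Equiv.addLeft g).hasSum_iff]
    simpa only [Function.comp_def, mul_apply_eq_comp, Equiv.coe_addLeft, hS.apply_vadd,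
      hT.apply_vadd] using hasSum_mul_apply_delta (S ω) (T ω (delta y)) x
  bounded := by
    obtain ⟨B, hB⟩ := hS.bounded
    obtain ⟨C, hC⟩ := hT.bounded
    exact ⟨B * C, fun ω => (norm_mul_le _ _).trans
      (mul_le_mul (hB ω) (hC ω) (norm_nonneg _) ((norm_nonneg _).trans (hB ω)))⟩

protected theorem pow [Countable G] (hT : IsCovariant T) (n : ℕ) :
    IsCovariant fun ω => T ω ^ n := by
  induction n with
  | zero => simpa only [pow_zero] using IsCovariant.one
  | succ n ih => simpa only [pow_succ] using ih.mul hT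

theorem starProjection_orthogonal {U : Ω → Submodule ℂ (ell2 G)}
    [∀ ω, (U ω).HasOrthogonalProjection] (hU : IsCovariant fun ω => (U ω).starProjection) :
    IsCovariant fun ω => (U ω)ᗮ.starProjection := by
  simpa only [Submodule.starProjection_orthogonal'] using IsCovariant.one.sub hU

theorem of_tendsto {F : ℕ → Ω → (ell2 G →L[ℂ] ell2 G)} (hF : ∀ n, IsCovariant (F n)) {C : ℝ}
    (hC : ∀ ω, ‖T ω‖ ≤ C) (hlim : ∀ ω φ, Tendsto (fun n => F n ω φ) atTop (𝓝 (T ω φ))) :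
    IsCovariant T where
  measurable x y := measurable_of_tendsto_metrizable (fun n => (hF n).measurable x y)
    (tendsto_pi_nhds.2 fun ω => tendsto_coe_apply (hlim ω (delta y)) x)
  apply_vadd g x y ω := by
    refine tendsto_nhds_unique (tendsto_coe_apply (hlim (g +ᵥ ω) (delta (g + y))) (g + x)) ?_
    simpa only [(hF _).apply_vadd] using tendsto_coe_apply (hlim ω (delta y)) x
  bounded := ⟨C, hC⟩

variable [Countable G]

protected theorem aeval (hT : IsCovariant T) (q : Polynomial ℝ) :
    IsCovariant fun ω => Polynomial.aeval (T ω) q := by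
  induction q using Polynomial.induction_on' with
  | add q r hq hr => simpa only [map_add] using hq.add hr
  | monomial n a => simpa only [aeval_monomial_eq_smul] using (hT.pow n).smul (a : ℂ)

protected theorem cfc (hT : IsCovariant T) (hsa : ∀ ω, IsSelfAdjoint (T ω)) {f : ℝ → ℝ}
    (hf : Continuous f) : IsCovariant fun ω => cfc f (T ω) := by
  obtain ⟨C, hC⟩ := hT.bounded
  obtain ⟨q, hq⟩ := exists_polynomial_tendstoUniformlyOn (a := -C) (b := C) hf.continuousOn
  obtain ⟨B, hB⟩ := (isCompact_Icc (a := -C) (b := C)).exists_bound_of_continuousOn hf.continuousOn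
  exact of_tendsto (fun n => hT.aeval (q n)) (fun ω => norm_cfc_le_of_norm_le (hC ω) hB)
    fun ω φ => tendsto_aeval_cfc_apply (hsa ω) (hC ω) hq φ

protected theorem heavisideOp (hT : IsCovariant T) (hsa : ∀ ω, IsSelfAdjoint (T ω)) (E : ℝ) :
    IsCovariant fun ω => heavisideOp (T ω) E :=
  of_tendsto (fun n => hT.cfc hsa (continuous_ramp E n))
    (fun _ => Submodule.starProjection_norm_le _)
    fun ω φ => tendsto_cfc_ramp (T ω) (hsa ω) E φ

theorem starProjection_ker (hT : IsCovariant T) :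
    IsCovariant fun ω => (T ω).ker.starProjection := by
  simpa only [heavisideOp_star_mul_self] using
    (hT.star.mul hT).heavisideOp (fun ω => IsSelfAdjoint.star_mul_self (T ω)) 0

end IsCovariant

end Covariant

section TracePerVolume

variable {Ω G : Type*} [MeasurableSpace Ω] [AddGroup G] [DecidableEq G]

/-- The trace per unit volume of a covariant family of operators: by covariance and invariance of
`μ`, the diagonal matrix element at the identity represents all diagonal matrix elements. -/
def tracePerVolume (μ : Measure Ω) (T : Ω → (ell2 G →L[ℂ] ell2 G)) : ℂ :=
  ∫ ω, T ω (delta 0) 0 ∂μ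

variable {μ : Measure Ω} {S T : Ω → (ell2 G →L[ℂ] ell2 G)}

theorem tracePerVolume_smul (c : ℂ) :
    tracePerVolume μ (fun ω => c • T ω) = c * tracePerVolume μ T :=
  integral_const_mul c _

theorem tendsto_tracePerVolume [IsFiniteMeasure μ] {F : ℕ → Ω → (ell2 G →L[ℂ] ell2 G)} {C : ℝ}
    (hmeas : ∀ n, Measurable fun ω => F n ω (delta 0) 0)
    (hC : ∀ᶠ n in atTop, ∀ ω, ‖F n ω‖ ≤ C)
    (hlim : ∀ ω φ, Tendsto (fun n => F n ω φ) atTop (𝓝 (T ω φ))) :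
    Tendsto (fun n => tracePerVolume μ (F n)) atTop (𝓝 (tracePerVolume μ T)) :=
  tendsto_integral_filter_of_dominated_convergence (fun _ => C)
    (Eventually.of_forall fun n => (hmeas n).aestronglyMeasurable)
    (hC.mono fun _ hn => ae_of_all _ fun ω => norm_apply_delta_apply_le (hn ω) 0 0)
    (integrable_const C) (ae_of_all _ fun ω => tendsto_coe_apply (hlim ω (delta 0)) 0)

variable [VAdd G Ω]

theorem IsCovariant.integrable [IsFiniteMeasure μ] (hT : IsCovariant T) (x y : G) :
    Integrable (fun ω => T ω (delta y) x) μ := by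
  obtain ⟨C, hC⟩ := hT.bounded
  exact Integrable.of_bound (hT.measurable x y).aestronglyMeasurable C
    (ae_of_all _ fun ω => norm_apply_delta_apply_le (hC ω) x y)

theorem tracePerVolume_add [IsFiniteMeasure μ] (hS : IsCovariant S) (hT : IsCovariant T) :
    tracePerVolume μ (fun ω => S ω + T ω) = tracePerVolume μ S + tracePerVolume μ T :=
  integral_add (hS.integrable 0 0) (hT.integrable 0 0)

theorem tracePerVolume_sub [IsFiniteMeasure μ] (hS : IsCovariant S) (hT : IsCovariant T) :
    tracePerVolume μ (fun ω => S ω - T ω) = tracePerVolume μ S - tracePerVolume μ T :=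
  integral_sub (hS.integrable 0 0) (hT.integrable 0 0)

theorem re_tracePerVolume_mono [IsFiniteMeasure μ] (hS : IsCovariant S) (hT : IsCovariant T)
    (hST : ∀ ω, S ω ≤ T ω) : (tracePerVolume μ S).re ≤ (tracePerVolume μ T).re := by
  rw [tracePerVolume, tracePerVolume, ← RCLike.re_eq_complex_re,
    ← integral_re (hS.integrable 0 0), ← integral_re (hT.integrable 0 0)]
  refine integral_mono (hS.integrable 0 0).re (hT.integrable 0 0).re fun ω => ?_
  have h := ((ContinuousLinearMap.le_def _ _).1 (hST ω)).re_inner_nonneg_right (delta 0)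
  rw [sub_apply, inner_sub_right, map_sub, inner_delta_left, inner_delta_left] at h
  exact sub_nonneg.1 h

theorem re_tracePerVolume_starProjection_orthogonal [IsProbabilityMeasure μ]
    {U : Ω → Submodule ℂ (ell2 G)}
    [∀ ω, (U ω).HasOrthogonalProjection] (hU : IsCovariant fun ω => (U ω).starProjection) :
    (tracePerVolume μ fun ω => (U ω)ᗮ.starProjection).re =
      1 - (tracePerVolume μ fun ω => (U ω).starProjection).re := by
  have h := tracePerVolume_add (μ := μ) hU.starProjection_orthogonal hU
  simp only [Submodule.starProjection_orthogonal', sub_add_cancel] at h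
  simp only [Submodule.starProjection_orthogonal']
  rw [eq_sub_iff_add_eq, ← Complex.add_re, ← h, tracePerVolume]
  simp [delta_apply]

theorem hasSum_integral_mul [Countable G] [IsProbabilityMeasure μ] (hS : IsCovariant S)
    (hT : IsCovariant T) :
    HasSum (fun z => ∫ ω, T ω (delta 0) z * S ω (delta z) 0 ∂μ)
      (tracePerVolume μ fun ω => S ω * T ω) := by
  obtain ⟨B, hB⟩ := hS.bounded
  obtain ⟨C, hC⟩ := hT.bounded
  have hint : ∀ z, Integrable (fun ω => T ω (delta 0) z * S ω (delta z) 0) μ := fun z =>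
    (hS.integrable 0 z).bdd_mul (hT.measurable z 0).aestronglyMeasurable
      (ae_of_all _ fun ω => norm_apply_delta_apply_le (hC ω) z 0)
  have hsum : Summable fun z => ∫ ω, ‖T ω (delta 0) z * S ω (delta z) 0‖ ∂μ := by
    refine summable_of_sum_le (c := C ^ 2 + B ^ 2)
      (fun z => integral_nonneg fun ω => norm_nonneg _) fun s => ?_
    calc ∑ z ∈ s, ∫ ω, ‖T ω (delta 0) z * S ω (delta z) 0‖ ∂μ
        = ∫ ω, ∑ z ∈ s, ‖T ω (delta 0) z * S ω (delta z) 0‖ ∂μ :=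
          (integral_finsetSum _ fun z _ => (hint z).norm).symm
      _ ≤ ∫ _, (C ^ 2 + B ^ 2) ∂μ :=
          integral_mono (integrable_finsetSum _ fun z _ => (hint z).norm) (integrable_const _)
            fun ω => sum_norm_mul_le (hB ω) (hC ω) 0 s
      _ = C ^ 2 + B ^ 2 := by simp
  have htsum : ∀ ω, ∑' z, T ω (delta 0) z * S ω (delta z) 0 = (S ω * T ω) (delta 0) 0 := fun ω =>
    (hasSum_mul_apply_delta (S ω) (T ω (delta 0)) 0).tsum_eq
  simpa only [tracePerVolume, htsum] using hasSum_integral_of_summable_integral_norm hint hsum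

variable [Countable G] [IsProbabilityMeasure μ]

theorem tendsto_tracePerVolume_aeval (hT : IsCovariant T) (hsa : ∀ ω, IsSelfAdjoint (T ω))
    {C : ℝ} (hC : ∀ ω, ‖T ω‖ ≤ C) {q : ℕ → Polynomial ℝ} {f : ℝ → ℝ}
    (hf : ContinuousOn f (Set.Icc (-C) C))
    (hq : TendstoUniformlyOn (fun n t => (q n).eval t) f atTop (Set.Icc (-C) C)) :
    Tendsto (fun n => tracePerVolume μ fun ω => Polynomial.aeval (T ω) (q n)) atTop
      (𝓝 (tracePerVolume μ fun ω => cfc f (T ω))) := by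
  obtain ⟨B, hB⟩ := isCompact_Icc.exists_bound_of_continuousOn hf
  refine tendsto_tracePerVolume (C := B + 1) (fun n => (hT.aeval (q n)).measurable 0 0) ?_
    fun ω φ => tendsto_aeval_cfc_apply (hsa ω) (hC ω) hq φ
  filter_upwards [Metric.tendstoUniformlyOn_iff.1 hq 1 one_pos] with n hn ω
  rw [← cfc_polynomial (q n) (T ω) (hsa ω)]
  refine norm_cfc_le_of_norm_le (hC ω) fun t ht => ?_
  calc ‖(q n).eval t‖ ≤ ‖f t‖ + dist (f t) ((q n).eval t) := by
        rw [dist_comm, dist_eq_norm]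
        exact norm_le_norm_add_norm_sub' _ _
    _ ≤ B + 1 := add_le_add (hB t ht) (hn t ht).le

theorem tendsto_tracePerVolume_ramp (hT : IsCovariant T) (hsa : ∀ ω, IsSelfAdjoint (T ω))
    (E : ℝ) :
    Tendsto (fun n => tracePerVolume μ fun ω => cfc (ramp E n) (T ω)) atTop
      (𝓝 (tracePerVolume μ fun ω => heavisideOp (T ω) E)) :=
  tendsto_tracePerVolume (C := 1)
    (fun n => (hT.cfc hsa (continuous_ramp E n)).measurable 0 0)
    (Eventually.of_forall fun n _ => norm_cfc_le zero_le_one fun t _ => norm_ramp_le_one E n t)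
    fun ω φ => tendsto_cfc_ramp (T ω) (hsa ω) E φ

variable [MeasurableConstVAdd G Ω] [VAddInvariantMeasure G Ω μ]

theorem tracePerVolume_mul_comm (hS : IsCovariant S) (hT : IsCovariant T) :
    tracePerVolume μ (fun ω => S ω * T ω) = tracePerVolume μ fun ω => T ω * S ω := by
  refine (hasSum_integral_mul hS hT).unique ?_
  rw [← (Equiv.neg G).hasSum_iff]
  convert hasSum_integral_mul (μ := μ) hT hS using 2 with z
  have hmeas : Measurable fun ω => T ω (delta 0) (-z) * S ω (delta (-z)) 0 :=
    (hT.measurable _ _).mul (hS.measurable _ _)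
  have hpres := measurePreserving_vadd (-z) μ
  rw [Function.comp_apply, Equiv.neg_apply, ← hpres.map_eq,
    integral_map hpres.measurable.aemeasurable hmeas.aestronglyMeasurable, hpres.map_eq]
  refine integral_congr_ae (ae_of_all _ fun ω => ?_)
  have hTz := hT.apply_vadd (-z) 0 z ω
  have hSz := hS.apply_vadd (-z) z 0 ω
  rw [neg_add_cancel, add_zero] at hTz hSz
  simp only [hTz, hSz, mul_comm]

theorem tracePerVolume_mul_pow_comm (hS : IsCovariant S) (hT : IsCovariant T) (n : ℕ) :
    tracePerVolume μ (fun ω => (S ω * T ω) ^ n) = tracePerVolume μ fun ω => (T ω * S ω) ^ n := by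
  cases n with
  | zero => simp only [pow_zero]
  | succ n =>
    have hleft : ∀ ω, (S ω * T ω) ^ (n + 1) = S ω * ((T ω * S ω) ^ n * T ω) := fun ω => by
      rw [pow_succ', mul_assoc, mul_pow_mul]
    have hright : ∀ ω, (T ω * S ω) ^ (n + 1) = (T ω * S ω) ^ n * T ω * S ω := fun ω => by
      rw [pow_succ, ← mul_assoc]
    simp only [hleft, hright]
    exact tracePerVolume_mul_comm hS (((hT.mul hS).pow n).mul hT)

theorem tracePerVolume_aeval_mul_comm (hS : IsCovariant S) (hT : IsCovariant T)
    (q : Polynomial ℝ) :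
    tracePerVolume μ (fun ω => Polynomial.aeval (S ω * T ω) q) =
      tracePerVolume μ fun ω => Polynomial.aeval (T ω * S ω) q := by
  induction q using Polynomial.induction_on' with
  | add q r hq hr =>
    simp only [map_add]
    rw [tracePerVolume_add ((hS.mul hT).aeval q) ((hS.mul hT).aeval r), hq, hr,
      tracePerVolume_add ((hT.mul hS).aeval q) ((hT.mul hS).aeval r)]
  | monomial n a =>
    simp only [aeval_monomial_eq_smul, tracePerVolume_smul]
    rw [tracePerVolume_mul_pow_comm hS hT]

theorem tracePerVolume_cfc_mul_comm (hS : IsCovariant S) (hT : IsCovariant T)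
    (hST : ∀ ω, IsSelfAdjoint (S ω * T ω)) (hTS : ∀ ω, IsSelfAdjoint (T ω * S ω)) {f : ℝ → ℝ}
    (hf : Continuous f) :
    tracePerVolume μ (fun ω => cfc f (S ω * T ω)) =
      tracePerVolume μ fun ω => cfc f (T ω * S ω) := by
  obtain ⟨B, hB⟩ := (hS.mul hT).bounded
  obtain ⟨C, hC⟩ := (hT.mul hS).bounded
  obtain ⟨q, hq⟩ := exists_polynomial_tendstoUniformlyOn (a := -max B C) (b := max B C)
    hf.continuousOn
  refine tendsto_nhds_unique (tendsto_tracePerVolume_aeval (hS.mul hT) hST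
    (fun ω => (hB ω).trans (le_max_left B C)) hf.continuousOn hq) ?_
  simp only [tracePerVolume_aeval_mul_comm hS hT]
  exact tendsto_tracePerVolume_aeval (hT.mul hS) hTS
    (fun ω => (hC ω).trans (le_max_right B C)) hf.continuousOn hq

theorem tracePerVolume_starProjection_ker_star (hT : IsCovariant T) :
    tracePerVolume μ (fun ω => (T ω).ker.starProjection) =
      tracePerVolume μ fun ω => (star (T ω)).ker.starProjection := by
  have hstar : ∀ ω, (star (T ω)).ker.starProjection = heavisideOp (T ω * star (T ω)) 0 :=
    fun ω => by simpa only [star_star] using (heavisideOp_star_mul_self (star (T ω))).symm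
  simp only [hstar, ← heavisideOp_star_mul_self]
  refine tendsto_nhds_unique (tendsto_tracePerVolume_ramp (hT.star.mul hT)
    (fun ω => IsSelfAdjoint.star_mul_self (T ω)) 0) ?_
  simp only [fun n => tracePerVolume_cfc_mul_comm (μ := μ) hT.star hT
    (fun ω => IsSelfAdjoint.star_mul_self (T ω)) (fun ω => IsSelfAdjoint.mul_star_self (T ω))
    (continuous_ramp 0 n)]
  exact tendsto_tracePerVolume_ramp (hT.mul hT.star)
    (fun ω => IsSelfAdjoint.mul_star_self (T ω)) 0

theorem re_tracePerVolume_starProjection_le {U V : Ω → Submodule ℂ (ell2 G)}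
    [∀ ω, (U ω).HasOrthogonalProjection] [∀ ω, (V ω).HasOrthogonalProjection]
    (hU : IsCovariant fun ω => (U ω).starProjection)
    (hV : IsCovariant fun ω => (V ω).starProjection) (hUV : ∀ ω, Disjoint (U ω) (V ω)ᗮ) :
    (tracePerVolume μ fun ω => (U ω).starProjection).re ≤
      (tracePerVolume μ fun ω => (V ω).starProjection).re := by
  have hker : (tracePerVolume μ fun ω => (U ω)ᗮ.starProjection) =
      tracePerVolume μ fun ω =>
        ((U ω).starProjection * (V ω).starProjection).ker.starProjection := by
    simpa only [ker_starProjection_mul_starProjection (hUV _), star_mul,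
      (isSelfAdjoint_starProjection _).star_eq] using
      tracePerVolume_starProjection_ker_star (μ := μ) (hV.mul hU)
  have hle : ∀ ω, (V ω)ᗮ.starProjection ≤
      ((U ω).starProjection * (V ω).starProjection).ker.starProjection := fun ω => by
    refine Submodule.starProjection_le_starProjection_iff.2 fun v hv => ?_
    rw [LinearMap.mem_ker, ContinuousLinearMap.coe_coe, mul_apply_eq_comp,
      (Submodule.starProjection_apply_eq_zero_iff _).2 hv, map_zero]
  have h := re_tracePerVolume_mono (μ := μ) hV.starProjection_orthogonal
    (hU.mul hV).starProjection_ker hle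
  rw [← hker, re_tracePerVolume_starProjection_orthogonal hU,
    re_tracePerVolume_starProjection_orthogonal hV] at h
  exact (sub_le_sub_iff_left 1).1 h

end TracePerVolume

section Laplacian

/-- The factor by which a function is extended across a missing edge: the three Laplacians arise
from the one of the full lattice by even reflection, extension by zero and odd reflection. -/
def reflectionSign : BoundaryCondition → ℝ
  | .neumann => 1
  | .pseudoDirichlet => 0
  | .dirichlet => -1

variable {V : Type*} (G : SimpleGraph V) [G.LocallyFinite] {d : ℕ}

theorem laplacian_eq (hG : ∀ x, G.degree x ≤ 2 * d) (X : BoundaryCondition) :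
    laplacian G hG X = ((1 - reflectionSign X : ℝ) : ℂ) • ((2 * d : ℂ) • 1 - degreeOp G hG) +
      (degreeOp G hG - adjacencyOp G hG) := by
  cases X with
  | neumann => simp [laplacian, reflectionSign]
  | pseudoDirichlet => simp [laplacian, reflectionSign, ContinuousLinearMap.one_def]
  | dirichlet =>
    norm_num [laplacian, reflectionSign]
    rfl

theorem norm_degreeOp_le (hG : ∀ x, G.degree x ≤ 2 * d) : ‖degreeOp G hG‖ ≤ 2 * d :=
  LinearMap.mkContinuous_norm_le _ (by positivity) _

theorem norm_adjacencyOp_le (hG : ∀ x, G.degree x ≤ 2 * d) : ‖adjacencyOp G hG‖ ≤ 2 * d :=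
  LinearMap.mkContinuous_norm_le _ (by positivity) _

open scoped ComplexOrder in
theorem laplacian_le_laplacian (hG : ∀ x, G.degree x ≤ 2 * d) {X Y : BoundaryCondition}
    (h : reflectionSign Y ≤ reflectionSign X) : laplacian G hG X ≤ laplacian G hG Y := by
  have hdeg : degreeOp G hG ≤ ((2 * d : ℝ) : ℂ) • 1 :=
    le_smul_one_of_norm_le (isSelfAdjoint_degreeOp G hG) (norm_degreeOp_le G hG)
  rw [laplacian_eq, laplacian_eq, ← sub_nonneg, add_sub_add_right_eq_sub, ← sub_smul,
    ← Complex.ofReal_sub]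
  push_cast at hdeg
  rw [ContinuousLinearMap.nonneg_iff_isPositive]
  exact ((ContinuousLinearMap.le_def _ _).1 hdeg).smul_of_nonneg
    (Complex.zero_le_real.2 (by linarith))

theorem degreeOp_apply_delta [DecidableEq V] (hG : ∀ x, G.degree x ≤ 2 * d) (x y : V) :
    degreeOp G hG (delta y) x = if x = y then (G.degree x : ℂ) else 0 := by
  rw [degreeOp_apply, delta_apply, mul_ite, mul_one, mul_zero]

theorem adjacencyOp_apply_delta [DecidableEq V] [DecidableRel G.Adj]
    (hG : ∀ x, G.degree x ≤ 2 * d) (x y : V) :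
    adjacencyOp G hG (delta y) x = if G.Adj x y then 1 else 0 := by
  simp only [adjacencyOp_apply, delta_apply, Finset.sum_ite_eq', SimpleGraph.mem_neighborFinset]

end Laplacian

section Lattice

variable {d : ℕ}

/-- The finite set of the `2d` nearest neighbours of `x` in the lattice. -/
def neighbors (x : Fin d → ℤ) : Finset (Fin d → ℤ) :=
  (Finset.univ ×ˢ ({1, -1} : Finset ℤ)).image fun q : Fin d × ℤ => x + Pi.single q.1 q.2

theorem mem_neighbors {x y : Fin d → ℤ} : y ∈ neighbors x ↔ (lattice d).Adj x y := by
  refine ⟨fun h => ?_, fun h => lattice_neighborSet_subset x h⟩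
  simp only [neighbors, Finset.mem_image, Finset.mem_product, Finset.mem_univ, true_and,
    Finset.mem_insert, Finset.mem_singleton] at h
  obtain ⟨⟨i, s⟩, hs, rfl⟩ := h
  change ∑ j, (x j - (x + Pi.single i s : Fin d → ℤ) j) ^ 2 = 1
  rw [Finset.sum_eq_single i (fun j _ hj => by simp [hj]) (by simp)]
  rcases hs with rfl | rfl <;> simp

theorem sum_neighbors {M : Type*} [AddCommMonoid M] (x : Fin d → ℤ) (f : (Fin d → ℤ) → M) :
    ∑ y ∈ neighbors x, f y = ∑ i, (f (x + Pi.single i 1) + f (x + Pi.single i (-1))) := by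
  have hinj : Set.InjOn (fun q : Fin d × ℤ => x + Pi.single q.1 q.2)
      (Finset.univ ×ˢ ({1, -1} : Finset ℤ) : Finset (Fin d × ℤ)) := by
    rintro ⟨i, s⟩ hi ⟨j, t⟩ - h
    have hst : (Pi.single i s : Fin d → ℤ) = Pi.single j t := add_left_cancel h
    have hs : s ≠ 0 := by
      rintro rfl
      simp at hi
    obtain rfl : i = j := by
      by_contra hij
      exact hs (by simpa [Pi.single_eq_of_ne hij] using congrFun hst i)
    rw [Pi.single_injective i hst]
  rw [neighbors, Finset.sum_image hinj, Finset.sum_product]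
  exact Finset.sum_congr rfl fun i _ => Finset.sum_pair (by decide)

theorem card_neighbors (x : Fin d → ℤ) : (neighbors x).card = 2 * d := by
  rw [Finset.card_eq_sum_ones, sum_neighbors]
  simp [mul_comm]

/-- Translation by `z` as an automorphism of the lattice. -/
def latticeShift (z : Fin d → ℤ) : lattice d ≃g lattice d where
  toEquiv := Equiv.addLeft z
  map_rel_iff' := by simp [lattice]

end Lattice

section Percolation

variable {d : ℕ}

/-- Configurations are translated along with the edges: `e + z` is open in `z +ᵥ ω` if and only if
`e` is open in `ω`. -/
instance : VAdd (Fin d → ℤ) (Config d) where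
  vadd z ω e := ω ((latticeShift z).mapEdgeSet.symm e)

theorem vadd_mapEdgeSet (z : Fin d → ℤ) (ω : Config d) (e : (lattice d).edgeSet) :
    (z +ᵥ ω) ((latticeShift z).mapEdgeSet e) = ω e :=
  congrArg ω ((latticeShift z).mapEdgeSet.symm_apply_apply e)

theorem vadd_eq_piCongrLeft (z : Fin d → ℤ) :
    ((z +ᵥ ·) : Config d → Config d) =
      MeasurableEquiv.piCongrLeft (fun _ => Bool) (latticeShift z).mapEdgeSet := by
  funext ω e
  obtain ⟨e, rfl⟩ := (latticeShift z).mapEdgeSet.surjective e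
  rw [vadd_mapEdgeSet, MeasurableEquiv.coe_piCongrLeft, Equiv.piCongrLeft_apply_apply]

instance : MeasurableConstVAdd (Fin d → ℤ) (Config d) where
  measurable_const_vadd z := by
    rw [vadd_eq_piCongrLeft]
    exact MeasurableEquiv.measurable _

instance (p : unitInterval) : IsProbabilityMeasure (percLaw d p) := by
  unfold percLaw
  infer_instance

instance (p : unitInterval) : VAddInvariantMeasure (Fin d → ℤ) (Config d) (percLaw d p) where
  measure_preimage_vadd z s hs := by
    have hmap : (percLaw d p).map (z +ᵥ ·) = percLaw d p := by
      rw [vadd_eq_piCongrLeft]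
      exact Measure.infinitePi_map_piCongrLeft (X := fun _ : (lattice d).edgeSet => Bool)
        (fun _ => bernoulliMeasure true false p) (latticeShift z).mapEdgeSet
    rw [← Measure.map_apply (measurable_const_vadd z) hs, hmap]

theorem percGraph_adj {ω : Config d} {x y : Fin d → ℤ} :
    (percGraph ω).Adj x y ↔ ∃ h : (lattice d).Adj x y, ω ⟨s(x, y), h⟩ = true := by
  rw [percGraph, SimpleGraph.fromEdgeSet_adj]
  exact ⟨And.left, fun h => ⟨h, h.1.ne⟩⟩

theorem percGraph_vadd_adj (z : Fin d → ℤ) (ω : Config d) (x y : Fin d → ℤ) :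
    (percGraph (z +ᵥ ω)).Adj (z + x) (z + y) ↔ (percGraph ω).Adj x y := by
  have hadj : (lattice d).Adj (z + x) (z + y) ↔ (lattice d).Adj x y :=
    (latticeShift z).map_rel_iff' (a := x) (b := y)
  simp only [percGraph_adj]
  exact ⟨fun ⟨h, hω⟩ => ⟨hadj.1 h, (vadd_mapEdgeSet z ω ⟨s(x, y), hadj.1 h⟩).symm.trans hω⟩,
    fun ⟨h, hω⟩ => ⟨hadj.2 h, (vadd_mapEdgeSet z ω ⟨s(x, y), h⟩).trans hω⟩⟩

/-- Translation by `z` as an isomorphism of percolation graphs. -/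
def percGraphShift (z : Fin d → ℤ) (ω : Config d) : percGraph ω ≃g percGraph (z +ᵥ ω) where
  toEquiv := Equiv.addLeft z
  map_rel_iff' := percGraph_vadd_adj z ω _ _

open Classical in
theorem percGraph_neighborFinset (ω : Config d) (x : Fin d → ℤ) :
    (percGraph ω).neighborFinset x = (neighbors x).filter ((percGraph ω).Adj x) := by
  ext y
  rw [SimpleGraph.mem_neighborFinset, Finset.mem_filter, mem_neighbors]
  exact (and_iff_right_of_imp fun h => percGraph_le ω h).symm

theorem measurableSet_percGraph_adj (x y : Fin d → ℤ) :
    MeasurableSet {ω : Config d | (percGraph ω).Adj x y} := by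
  simp only [percGraph_adj, Set.ofPred_exists]
  refine MeasurableSet.iUnion fun h => ?_
  have heval : Measurable fun ω : Config d => ω ⟨s(x, y), h⟩ := measurable_pi_apply _
  exact heval (measurableSet_singleton true)

theorem isCovariant_adjacencyOp :
    IsCovariant fun ω : Config d => adjacencyOp (percGraph ω) (percGraph_degree_le ω) := by
  classical
  refine ⟨fun x y => ?_, fun z x y ω => ?_, 2 * d, fun ω => norm_adjacencyOp_le _ _⟩
  · simp only [adjacencyOp_apply_delta]
    exact Measurable.ite (measurableSet_percGraph_adj x y) measurable_const measurable_const
  · simp only [adjacencyOp_apply_delta, percGraph_vadd_adj]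

theorem isCovariant_degreeOp :
    IsCovariant fun ω : Config d => degreeOp (percGraph ω) (percGraph_degree_le ω) := by
  classical
  refine ⟨fun x y => ?_, fun z x y ω => ?_, 2 * d, fun ω => norm_degreeOp_le _ _⟩
  · simp only [degreeOp_apply, ← SimpleGraph.card_neighborFinset_eq_degree,
      percGraph_neighborFinset, ← Finset.sum_boole]
    refine (Finset.measurable_sum _ fun z _ => ?_).mul_const _
    exact Measurable.ite (measurableSet_percGraph_adj x z) measurable_const measurable_const
  · have hdeg : (percGraph (z +ᵥ ω)).degree (z + x) = (percGraph ω).degree x :=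
      (percGraphShift z ω).degree_eq x
    simp only [degreeOp_apply_delta, hdeg, add_right_inj]

theorem isCovariant_percLaplacian (X : BoundaryCondition) :
    IsCovariant fun ω : Config d => percLaplacian X ω := by
  simp only [percLaplacian, laplacian_eq]
  exact (((IsCovariant.one.smul _).sub isCovariant_degreeOp).smul _).add
    (isCovariant_degreeOp.sub isCovariant_adjacencyOp)

theorem isSelfAdjoint_percLaplacian (X : BoundaryCondition) (ω : Config d) :
    IsSelfAdjoint (percLaplacian X ω) :=
  isSelfAdjoint_laplacian _ _ X

open Classical in
theorem percLaplacian_apply (X : BoundaryCondition) (ω : Config d) (φ : ell2 (Fin d → ℤ))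
    (x : Fin d → ℤ) :
    percLaplacian X ω φ x = ∑ y ∈ neighbors x,
      (φ x - if (percGraph ω).Adj x y then φ y else (reflectionSign X : ℂ) * φ x) := by
  have hdeg : ((percGraph ω).degree x : ℂ) =
      ∑ y ∈ neighbors x, if (percGraph ω).Adj x y then 1 else 0 := by
    rw [Finset.sum_boole, ← percGraph_neighborFinset, SimpleGraph.card_neighborFinset_eq_degree]
  have hcard : (2 * d : ℂ) = ∑ y ∈ neighbors x, 1 := by
    rw [Finset.sum_const, card_neighbors, nsmul_one]
    push_cast
    rfl
  have hlap : percLaplacian X ω φ x =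
      (1 - reflectionSign X : ℝ) * (2 * d * φ x - (percGraph ω).degree x * φ x) +
        ((percGraph ω).degree x * φ x - ∑ y ∈ (percGraph ω).neighborFinset x, φ y) := by
    rw [percLaplacian, laplacian_eq]
    rfl
  rw [hlap, hdeg, hcard, percGraph_neighborFinset, Finset.sum_filter, ← sub_mul,
    ← Finset.sum_sub_distrib, Finset.sum_mul, Finset.sum_mul, Finset.mul_sum,
    ← Finset.sum_sub_distrib, ← Finset.sum_add_distrib]
  refine Finset.sum_congr rfl fun y _ => ?_
  split_ifs <;> push_cast <;> ring

theorem isCovariant_heavisideOp_percLaplacian (X : BoundaryCondition) (E : ℝ) :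
    IsCovariant fun ω : Config d => heavisideOp (percLaplacian X ω) E :=
  (isCovariant_percLaplacian X).heavisideOp (isSelfAdjoint_percLaplacian X) E

theorem ids_eq_re_tracePerVolume (p : unitInterval) (X : BoundaryCondition) (E : ℝ) :
    ids d p X E =
      (tracePerVolume (percLaw d p) fun ω => heavisideOp (percLaplacian X ω) E).re := by
  simp only [ids, inner_delta_left]
  exact integral_re ((isCovariant_heavisideOp_percLaplacian X E).integrable 0 0)

theorem ids_le_ids (p : unitInterval) {X Y : BoundaryCondition}
    (h : reflectionSign X ≤ reflectionSign Y) (E : ℝ) : ids d p X E ≤ ids d p Y E := by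
  have hX := isCovariant_heavisideOp_percLaplacian (d := d) X E
  have hY := isCovariant_heavisideOp_percLaplacian (d := d) Y E
  simp only [ids_eq_re_tracePerVolume, heavisideOp_eq_starProjection] at hX hY ⊢
  exact re_tracePerVolume_starProjection_le hX hY fun ω => disjoint_spectralSubspace_orthogonal
    (isSelfAdjoint_percLaplacian Y ω) (isSelfAdjoint_percLaplacian X ω)
    (laplacian_le_laplacian _ _ h) E

end Percolation

section RestrictTo

variable {V : Type*} [DecidableEq V] {S : Finset V} {F : V → ℝ}

/-- The element of `ℓ²` that agrees with the real function `F` on the finite set `S` and vanishes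
off `S`; it serves as a finitely supported trial function. -/
def restrictTo (S : Finset V) (F : V → ℝ) : ell2 V :=
  ∑ x ∈ S, (F x : ℂ) • delta x

theorem restrictTo_apply (y : V) :
    restrictTo S F y = if y ∈ S then (F y : ℂ) else 0 := by
  rw [← inner_delta_left, restrictTo, inner_sum]
  simp only [inner_smul_right, inner_delta_left, delta_apply, mul_ite, mul_one, mul_zero,
    Finset.sum_ite_eq]

theorem norm_sq_restrictTo : ‖restrictTo S F‖ ^ 2 = ∑ x ∈ S, F x ^ 2 := by
  have h : (inner ℂ (restrictTo S F) (restrictTo S F) : ℂ) = ((∑ x ∈ S, F x ^ 2 : ℝ) : ℂ) := by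
    conv_lhs => enter [2]; rw [restrictTo]
    rw [sum_inner]
    push_cast
    refine Finset.sum_congr rfl fun x hx => ?_
    rw [inner_smul_left, inner_delta_left, restrictTo_apply, if_pos hx, Complex.conj_ofReal, sq]
  rw [← inner_self_eq_norm_sq (𝕜 := ℂ), h]
  exact Complex.ofReal_re _

theorem sq_div_card_le_re_inner_delta {R : ell2 V →L[ℂ] ell2 V} (hR : IsStarProjection R)
    (hF : ∀ x ∈ S, |F x| ≤ 1) (hfix : R (restrictTo S F) = restrictTo S F) {x : V} (hx : x ∈ S) :
    F x ^ 2 / S.card ≤ (R (delta x) x).re := by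
  have hS : (0 : ℝ) < S.card := by exact_mod_cast Finset.card_pos.2 ⟨x, hx⟩
  have hnorm : ‖restrictTo S F‖ ^ 2 ≤ S.card := by
    rw [norm_sq_restrictTo, ← nsmul_one]
    exact Finset.sum_le_card_nsmul S _ 1 fun y hy => (sq_le_one_iff_abs_le_one _).2 (hF y hy)
  have hcs := norm_inner_sq_le_of_isStarProjection hR hfix (delta x)
  rw [inner_delta_right, inner_delta_left, RCLike.norm_conj, restrictTo_apply, if_pos hx,
    Complex.norm_real, Real.norm_eq_abs, sq_abs] at hcs
  have hpos : 0 ≤ (R (delta x) x).re := by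
    rw [← inner_delta_left]
    exact (ContinuousLinearMap.IsPositive.of_isStarProjection hR).re_inner_nonneg_right _
  rw [div_le_iff₀' hS]
  exact hcs.trans (mul_le_mul_of_nonneg_right hnorm hpos)

end RestrictTo

section Isolated

variable {d : ℕ} {S : Finset (Fin d → ℤ)} {F : (Fin d → ℤ) → ℝ}

/-- The event that all edges inside `S` are open and all edges leaving `S` are closed. -/
def isolated (S : Finset (Fin d → ℤ)) : Set (Config d) :=
  {ω | ∀ x ∈ S, ∀ y ∈ neighbors x, (percGraph ω).Adj x y ↔ y ∈ S}

/-- The function `F` is a discrete eigenfunction with eigenvalue `l` for the Laplacian of the full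
lattice on `S`, and each of its values outside `S` is `σ` times the adjacent value inside `S`. -/
structure IsReflectedMode (σ l : ℝ) (S : Finset (Fin d → ℤ)) (F : (Fin d → ℤ) → ℝ) : Prop where
  reflect : ∀ x ∈ S, ∀ y ∈ neighbors x, y ∉ S → F y = σ * F x
  sum_neighbors_sub : ∀ x ∈ S, ∑ y ∈ neighbors x, (F x - F y) = l * F x

theorem IsReflectedMode.percLaplacian_restrictTo {X : BoundaryCondition} {l : ℝ}
    (hF : IsReflectedMode (reflectionSign X) l S F) {ω : Config d} (hω : ω ∈ isolated S) :
    percLaplacian X ω (restrictTo S F) = (l : ℂ) • restrictTo S F := by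
  classical
  ext x
  rw [percLaplacian_apply]
  change _ = (l : ℂ) * restrictTo S F x
  by_cases hx : x ∈ S
  · rw [restrictTo_apply, if_pos hx, ← Complex.ofReal_mul l, ← hF.sum_neighbors_sub x hx,
      Complex.ofReal_sum]
    refine Finset.sum_congr rfl fun y hy => ?_
    rw [hω x hx y hy, restrictTo_apply, Complex.ofReal_sub]
    by_cases hyS : y ∈ S
    · simp only [hyS, if_true]
    · rw [if_neg hyS, hF.reflect x hx y hy hyS, Complex.ofReal_mul]
  · rw [restrictTo_apply, if_neg hx, mul_zero, mul_zero]
    refine Finset.sum_eq_zero fun y hy => ?_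
    have hadj : (percGraph ω).Adj x y → y ∉ S := fun hxy hyS =>
      hx ((hω y hyS x (mem_neighbors.2 (mem_neighbors.1 hy).symm)).1 hxy.symm)
    split_ifs with hxy
    · rw [restrictTo_apply, if_neg (hadj hxy), sub_zero]
    · rw [sub_zero]

theorem min_le_bernoulliMeasure_real_singleton (p : unitInterval) (b : Bool) :
    min (p : ℝ) (1 - p) ≤ (bernoulliMeasure true false p).real {b} := by
  cases b with
  | true =>
    rw [bernoulliMeasure_real_apply_of_mem_of_notMem p (measurableSet_singleton _) (by simp)
      (by simp)]
    exact min_le_left _ _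
  | false =>
    rw [bernoulliMeasure_real_apply_of_notMem_of_mem p (measurableSet_singleton _) (by simp)
      (by simp)]
    exact min_le_right _ _

theorem min_pow_card_le_percLaw_real_pi (p : unitInterval) (A : Finset (lattice d).edgeSet)
    (b : (lattice d).edgeSet → Bool) :
    min (p : ℝ) (1 - p) ^ A.card ≤ (percLaw d p).real (Set.pi A fun e => {b e}) := by
  rw [percLaw, measureReal_def, Measure.infinitePi_pi _ fun _ _ => measurableSet_singleton _,
    ENNReal.toReal_prod, ← Finset.prod_const]
  exact Finset.prod_le_prod (fun _ _ => le_min p.2.1 (sub_nonneg.2 p.2.2))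
    fun e _ => min_le_bernoulliMeasure_real_singleton p (b e)

open Classical in
/-- The finite set of lattice edges with at least one endpoint in `S`. -/
def incidentEdges (S : Finset (Fin d → ℤ)) : Finset (lattice d).edgeSet :=
  (S.sigma neighbors).attach.image
    fun q => ⟨s(q.1.1, q.1.2), mem_neighbors.1 (Finset.mem_sigma.1 q.2).2⟩

theorem mk_mem_incidentEdges {x y : Fin d → ℤ} (hx : x ∈ S) (h : (lattice d).Adj x y) :
    (⟨s(x, y), h⟩ : (lattice d).edgeSet) ∈ incidentEdges S :=
  Finset.mem_image.2
    ⟨⟨⟨x, y⟩, Finset.mem_sigma.2 ⟨hx, mem_neighbors.2 h⟩⟩, Finset.mem_attach _ _, rfl⟩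

theorem card_incidentEdges_le (S : Finset (Fin d → ℤ)) :
    (incidentEdges S).card ≤ 2 * d * S.card := by
  refine Finset.card_image_le.trans_eq ?_
  simp only [Finset.card_attach, Finset.card_sigma, card_neighbors, Finset.sum_const,
    smul_eq_mul, mul_comm]

open Classical in
theorem pi_incidentEdges_subset_isolated (S : Finset (Fin d → ℤ)) :
    Set.pi (incidentEdges S) (fun e => {decide (∀ v ∈ e.1, v ∈ S)}) ⊆ isolated S := by
  intro ω hω x hx y hy
  have hadj : (lattice d).Adj x y := mem_neighbors.1 hy
  have hopen : ω ⟨s(x, y), hadj⟩ = decide (∀ v ∈ s(x, y), v ∈ S) :=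
    hω _ (Finset.mem_coe.2 (mk_mem_incidentEdges hx hadj))
  rw [percGraph_adj, exists_prop_of_true hadj, hopen, decide_eq_true_iff]
  simp [Sym2.mem_iff, hx]

theorem min_pow_le_percLaw_real_isolated (p : unitInterval) (S : Finset (Fin d → ℤ)) :
    min (p : ℝ) (1 - p) ^ (2 * d * S.card) ≤ (percLaw d p).real (isolated S) := by
  classical
  exact (pow_le_pow_of_le_one (le_min p.2.1 (sub_nonneg.2 p.2.2))
      ((min_le_left _ _).trans p.2.2) (card_incidentEdges_le S)).trans
    ((min_pow_card_le_percLaw_real_pi p _ _).trans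
      (measureReal_mono (pi_incidentEdges_subset_isolated S)))

theorem sq_div_card_mul_min_pow_le_re_tracePerVolume (p : unitInterval)
    {R : Config d → (ell2 (Fin d → ℤ) →L[ℂ] ell2 (Fin d → ℤ))} (hR : IsCovariant R)
    (hproj : ∀ ω, IsStarProjection (R ω)) (h0 : 0 ∈ S) (hF : ∀ x ∈ S, |F x| ≤ 1)
    (hfix : ∀ ω ∈ isolated S, R ω (restrictTo S F) = restrictTo S F) :
    F 0 ^ 2 / S.card * min (p : ℝ) (1 - p) ^ (2 * d * S.card) ≤
      (tracePerVolume (percLaw d p) R).re := by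
  have hint : Integrable (fun ω => R ω (delta 0) 0) (percLaw d p) := hR.integrable 0 0
  have hnonneg : ∀ ω, 0 ≤ (R ω (delta 0) 0).re := fun ω => by
    rw [← inner_delta_left]
    exact (ContinuousLinearMap.IsPositive.of_isStarProjection (hproj ω)).re_inner_nonneg_right _
  calc F 0 ^ 2 / S.card * min (p : ℝ) (1 - p) ^ (2 * d * S.card)
      ≤ F 0 ^ 2 / S.card *
          (percLaw d p).real {ω | F 0 ^ 2 / S.card ≤ (R ω (delta 0) 0).re} := by
        refine mul_le_mul_of_nonneg_left ((min_pow_le_percLaw_real_isolated p S).trans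
          (measureReal_mono fun ω hω => ?_)) (by positivity)
        exact sq_div_card_le_re_inner_delta (hproj ω) hF (hfix ω hω) h0
    _ ≤ ∫ ω, (R ω (delta 0) 0).re ∂percLaw d p :=
        mul_meas_ge_le_integral_of_nonneg (ae_of_all _ hnonneg) hint.re _
    _ = (tracePerVolume (percLaw d p) R).re := integral_re hint

theorem IsReflectedMode.sq_div_card_mul_min_pow_le_ids_sub {X : BoundaryCondition} {l : ℝ}
    (hF : IsReflectedMode (reflectionSign X) l S F) (p : unitInterval) (h0 : 0 ∈ S)
    (hF1 : ∀ x ∈ S, |F x| ≤ 1) {E₀ E : ℝ} (hl₀ : E₀ < l) (hl : l ≤ E) :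
    F 0 ^ 2 / S.card * min (p : ℝ) (1 - p) ^ (2 * d * S.card) ≤ ids d p X E - ids d p X E₀ := by
  have hcov := isCovariant_heavisideOp_percLaplacian (d := d) X
  rw [ids_eq_re_tracePerVolume, ids_eq_re_tracePerVolume, ← Complex.sub_re,
    ← tracePerVolume_sub (hcov E) (hcov E₀)]
  refine sq_div_card_mul_min_pow_le_re_tracePerVolume p ((hcov E).sub (hcov E₀))
    (fun ω => isStarProjection_heavisideOp_sub _ (hl₀.le.trans hl)) h0 hF1 fun ω hω => ?_
  have heigen := hF.percLaplacian_restrictTo hω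
  rw [sub_apply,
    heavisideOp_apply_of_apply_eq_smul (isSelfAdjoint_percLaplacian X ω) hl heigen,
    heavisideOp_apply_eq_zero_of_apply_eq_smul (isSelfAdjoint_percLaplacian X ω) hl₀ heigen,
    sub_zero]

theorem ids_nonneg (p : unitInterval) (X : BoundaryCondition) (E : ℝ) : 0 ≤ ids d p X E :=
  integral_nonneg fun ω => (ContinuousLinearMap.IsPositive.of_isStarProjection
    (isStarProjection_heavisideOp (percLaplacian X ω) E)).re_inner_nonneg_right _

theorem IsReflectedMode.sq_div_card_mul_min_pow_le_ids {X : BoundaryCondition} {l : ℝ}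
    (hF : IsReflectedMode (reflectionSign X) l S F) (p : unitInterval) (h0 : 0 ∈ S)
    (hF1 : ∀ x ∈ S, |F x| ≤ 1) {E : ℝ} (hl : l ≤ E) :
    F 0 ^ 2 / S.card * min (p : ℝ) (1 - p) ^ (2 * d * S.card) ≤ ids d p X E :=
  (hF.sq_div_card_mul_min_pow_le_ids_sub p h0 hF1 (sub_one_lt l) hl).trans
    (sub_le_self _ (ids_nonneg p X _))

end Isolated

section Boxes

variable {d : ℕ}

/-- The box `∏ᵢ {0, …, mᵢ - 1}`. -/
def box (m : Fin d → ℕ) : Finset (Fin d → ℤ) := Fintype.piFinset fun i => Finset.Ico 0 (m i : ℤ)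

theorem mem_box {m : Fin d → ℕ} {x : Fin d → ℤ} : x ∈ box m ↔ ∀ i, 0 ≤ x i ∧ x i < m i := by
  simp [box]

theorem card_box (m : Fin d → ℕ) : (box m).card = ∏ i, m i := by
  simp [box]

theorem zero_mem_box {m : Fin d → ℕ} (hm : ∀ i, 0 < m i) : 0 ∈ box m :=
  mem_box.2 fun i => ⟨le_rfl, Int.natCast_pos.2 (hm i)⟩

theorem prod_add_single {ι M : Type*} [Fintype ι] [DecidableEq ι] [CommMonoid M]
    (g : ι → ℤ → M) (x : ι → ℤ) (i : ι) (s : ℤ) :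
    ∏ j, g j ((x + Pi.single i s : ι → ℤ) j) =
      g i (x i + s) * ∏ j ∈ Finset.univ.erase i, g j (x j) := by
  rw [← Finset.mul_prod_erase _ _ (Finset.mem_univ i), Pi.add_apply, Pi.single_eq_same]
  congr 1
  refine Finset.prod_congr rfl fun j hj => ?_
  rw [Pi.add_apply, Pi.single_eq_of_ne (Finset.ne_of_mem_erase hj), add_zero]

/-- The one-dimensional analogue of `IsReflectedMode` for the interval `{0, …, n - 1}`; the
eigenvalue equation is required on all of `ℤ`. -/
structure IsIntervalMode (σ l : ℝ) (n : ℕ) (g : ℤ → ℝ) : Prop where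
  add_sub_one : ∀ k, g (k + 1) + g (k - 1) = (2 - l) * g k
  apply_neg_one : g (-1) = σ * g 0
  apply_length : g n = σ * g (n - 1)

variable {σ : ℝ} {l : Fin d → ℝ} {m : Fin d → ℕ} {g : Fin d → ℤ → ℝ}

theorem IsIntervalMode.isReflectedMode_prod (hg : ∀ i, IsIntervalMode σ (l i) (m i) (g i)) :
    IsReflectedMode σ (∑ i, l i) (box m) fun x => ∏ i, g i (x i) where
  reflect x hx y hy hyS := by
    simp only [neighbors, Finset.mem_image, Finset.mem_product, Finset.mem_univ, true_and,
      Finset.mem_insert, Finset.mem_singleton] at hy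
    obtain ⟨⟨i, s⟩, hs, rfl⟩ := hy
    rw [mem_box] at hx hyS
    have hexit : ¬(0 ≤ x i + s ∧ x i + s < m i) := fun h => hyS fun j => by
      rcases eq_or_ne j i with rfl | hj
      · simpa using h
      · simpa [hj] using hx j
    rw [prod_add_single, ← Finset.mul_prod_erase _ _ (Finset.mem_univ i), ← mul_assoc]
    congr 1
    have hxi := hx i
    rcases hs with rfl | rfl
    · rw [show x i = m i - 1 by omega, sub_add_cancel, (hg i).apply_length]
    · rw [show x i = 0 by omega, zero_add, (hg i).apply_neg_one]
  sum_neighbors_sub x _ := by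
    rw [sum_neighbors, Finset.sum_mul]
    refine Finset.sum_congr rfl fun i _ => ?_
    rw [prod_add_single, prod_add_single, ← Finset.mul_prod_erase _ _ (Finset.mem_univ i),
      ← sub_eq_add_neg]
    linear_combination (-∏ j ∈ Finset.univ.erase i, g j (x j)) * (hg i).add_sub_one (x i)

end Boxes

section IntervalModes

theorem isIntervalMode_one (n : ℕ) : IsIntervalMode 1 0 n 1 := by
  constructor <;> norm_num

/-- The centres `π (k + 1/2) / n` of the cells obtained by dividing `[0, π]` into `n` equal parts,
continued to all `k : ℤ`. The half-integer shift places both reflections of an interval mode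
midway between lattice sites. -/
def midAngle (n : ℕ) (k : ℤ) : ℝ := Real.pi * (k + 1 / 2) / n

variable {n : ℕ}

theorem midAngle_add_one (n : ℕ) (k : ℤ) : midAngle n (k + 1) = midAngle n k + Real.pi / n := by
  simp only [midAngle]
  push_cast
  ring

theorem midAngle_sub_one (n : ℕ) (k : ℤ) : midAngle n (k - 1) = midAngle n k - Real.pi / n := by
  simp only [midAngle]
  push_cast
  ring

theorem midAngle_neg_one (n : ℕ) : midAngle n (-1) = -midAngle n 0 := by
  simp only [midAngle]
  push_cast
  ring

theorem midAngle_length (hn : n ≠ 0) : midAngle n n = midAngle n 0 + Real.pi := by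
  simp only [midAngle]
  push_cast
  field_simp
  ring

theorem midAngle_length_sub_one (hn : n ≠ 0) : midAngle n (n - 1) = Real.pi - midAngle n 0 := by
  simp only [midAngle]
  push_cast
  field_simp
  ring

theorem midAngle_zero (n : ℕ) : midAngle n 0 = Real.pi / (2 * n) := by
  simp only [midAngle]
  push_cast
  ring

theorem isIntervalMode_cos (hn : n ≠ 0) :
    IsIntervalMode 1 (2 - 2 * Real.cos (Real.pi / n)) n fun k => Real.cos (midAngle n k) where
  add_sub_one k := by
    rw [midAngle_add_one, midAngle_sub_one, Real.cos_add, Real.cos_sub]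
    ring
  apply_neg_one := by rw [midAngle_neg_one, Real.cos_neg, one_mul]
  apply_length := by
    rw [midAngle_length hn, midAngle_length_sub_one hn, Real.cos_add_pi, Real.cos_pi_sub, one_mul]

theorem isIntervalMode_sin (hn : n ≠ 0) :
    IsIntervalMode (-1) (2 - 2 * Real.cos (Real.pi / n)) n fun k => Real.sin (midAngle n k) where
  add_sub_one k := by
    rw [midAngle_add_one, midAngle_sub_one, Real.sin_add, Real.sin_sub]
    ring
  apply_neg_one := by rw [midAngle_neg_one, Real.sin_neg, neg_one_mul]
  apply_length := by
    rw [midAngle_length hn, midAngle_length_sub_one hn, Real.sin_add_pi, Real.sin_pi_sub,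
      neg_one_mul]

theorem two_sub_two_mul_cos_le (θ : ℝ) : 2 - 2 * Real.cos θ ≤ θ ^ 2 := by
  linarith [Real.one_sub_sq_div_two_le_cos (x := θ)]

theorem two_sub_two_mul_cos_pi_div_pos (hn : n ≠ 0) : 0 < 2 - 2 * Real.cos (Real.pi / n) := by
  have hn' : (1 : ℝ) ≤ n := by exact_mod_cast Nat.one_le_iff_ne_zero.2 hn
  have h := Real.cos_lt_cos_of_nonneg_of_le_pi le_rfl
    (div_le_self Real.pi_pos.le hn') (div_pos Real.pi_pos (by linarith))
  rw [Real.cos_zero] at h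
  linarith

theorem half_le_sq_cos_midAngle_zero (hn : 2 ≤ n) : 1 / 2 ≤ Real.cos (midAngle n 0) ^ 2 := by
  have hn' : (2 : ℝ) ≤ n := by exact_mod_cast hn
  have hangle : midAngle n 0 ≤ Real.pi / 4 := by
    rw [midAngle_zero]
    exact div_le_div_of_nonneg_left Real.pi_pos.le (by norm_num) (by linarith)
  have hnonneg : 0 ≤ midAngle n 0 := by
    rw [midAngle_zero]
    positivity
  calc (1 / 2 : ℝ) = Real.cos (Real.pi / 4) ^ 2 := by
        rw [Real.cos_pi_div_four, div_pow, Real.sq_sqrt (by norm_num)]; norm_num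
    _ ≤ Real.cos (midAngle n 0) ^ 2 := by
        refine pow_le_pow_left₀ (by rw [Real.cos_pi_div_four]; positivity) ?_ 2
        exact Real.cos_le_cos_of_nonneg_of_le_pi hnonneg (by linarith [Real.pi_pos]) hangle

theorem inv_le_sin_midAngle_zero (hn : n ≠ 0) : (n : ℝ)⁻¹ ≤ Real.sin (midAngle n 0) := by
  have hn' : (1 : ℝ) ≤ n := by exact_mod_cast Nat.one_le_iff_ne_zero.2 hn
  rw [midAngle_zero]
  have h := Real.mul_le_sin (x := Real.pi / (2 * n)) (by positivity)
    (div_le_div_of_nonneg_left Real.pi_pos.le (by norm_num) (by linarith))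
  refine le_of_eq_of_le ?_ h
  field_simp

end IntervalModes

section LowerBounds

variable {d n : ℕ}

theorem one_div_sq_mul_min_pow_le_ids_neumann_sub (hd : 1 ≤ d) (p : unitInterval) (hn : 2 ≤ n)
    {E : ℝ} (hE : (Real.pi / n) ^ 2 ≤ E) :
    1 / (n : ℝ) ^ 2 * min (p : ℝ) (1 - p) ^ (2 * d * n) ≤
      ids d p .neumann E - ids d p .neumann 0 := by
  have hn0 : n ≠ 0 := by omega
  let i₀ : Fin d := ⟨0, hd⟩
  let l : Fin d → ℝ := fun i => if i = i₀ then 2 - 2 * Real.cos (Real.pi / n) else 0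
  let m : Fin d → ℕ := fun i => if i = i₀ then n else 1
  let g : Fin d → ℤ → ℝ := fun i => if i = i₀ then fun k => Real.cos (midAngle n k) else 1
  have hg : ∀ i, IsIntervalMode (reflectionSign .neumann) (l i) (m i) (g i) := fun i => by
    rcases eq_or_ne i i₀ with hi | hi
    · simpa only [l, m, g, if_pos hi, reflectionSign] using isIntervalMode_cos hn0
    · simpa only [l, m, g, if_neg hi, reflectionSign] using isIntervalMode_one 1
  have hl : ∑ i, l i = 2 - 2 * Real.cos (Real.pi / n) := by simp [l]
  have hcard : (box m).card = n := by simp [card_box, m]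
  have hprod : ∀ x : Fin d → ℤ, ∏ i, g i (x i) = Real.cos (midAngle n (x i₀)) := by
    simp [g, ite_apply]
  have hmem : (0 : Fin d → ℤ) ∈ box m :=
    zero_mem_box fun i => by by_cases hi : i = i₀ <;> simp [m, hi]; omega
  have key := (IsIntervalMode.isReflectedMode_prod hg).sq_div_card_mul_min_pow_le_ids_sub p hmem
    (fun x _ => (hprod x).symm ▸ Real.abs_cos_le_one _)
    (hl ▸ two_sub_two_mul_cos_pi_div_pos hn0) (hl ▸ (two_sub_two_mul_cos_le _).trans hE)
  simp only [hprod, hcard, Pi.zero_apply] at key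
  refine (mul_le_mul_of_nonneg_right ?_ ?_).trans key
  · calc 1 / (n : ℝ) ^ 2 = 1 / n / n := by rw [div_div, sq]
      _ ≤ Real.cos (midAngle n 0) ^ 2 / n := by
        gcongr
        exact (one_div_le_one_div_of_le two_pos (by exact_mod_cast hn)).trans
          (half_le_sq_cos_midAngle_zero hn)
  · exact pow_nonneg (le_min p.2.1 (sub_nonneg.2 p.2.2)) _

theorem one_div_pow_mul_min_pow_le_ids_dirichlet (p : unitInterval) (hn : n ≠ 0) {E : ℝ}
    (hE : d * (Real.pi / n) ^ 2 ≤ E) :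
    1 / (n : ℝ) ^ (3 * d) * min (p : ℝ) (1 - p) ^ (2 * d * n ^ d) ≤ ids d p .dirichlet E := by
  have hmode : IsReflectedMode (reflectionSign .dirichlet)
      (∑ _i : Fin d, (2 - 2 * Real.cos (Real.pi / n))) (box fun _ => n)
      fun x => ∏ i, Real.sin (midAngle n (x i)) :=
    IsIntervalMode.isReflectedMode_prod fun _ => isIntervalMode_sin hn
  have hl : ∑ _i : Fin d, (2 - 2 * Real.cos (Real.pi / n)) ≤ E := by
    rw [Finset.sum_const, Finset.card_univ, Fintype.card_fin, nsmul_eq_mul]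
    exact (mul_le_mul_of_nonneg_left (two_sub_two_mul_cos_le _) d.cast_nonneg).trans hE
  have hmem : (0 : Fin d → ℤ) ∈ box fun _ => n := zero_mem_box fun _ => Nat.pos_of_ne_zero hn
  have hle : ∀ x : Fin d → ℤ, |∏ i, Real.sin (midAngle n (x i))| ≤ 1 := fun x => by
    rw [Finset.abs_prod]
    exact Finset.prod_le_one (fun _ _ => abs_nonneg _) fun _ _ => Real.abs_sin_le_one _
  have key := hmode.sq_div_card_mul_min_pow_le_ids p hmem (fun x _ => hle x) hl
  simp only [card_box, Pi.zero_apply, Finset.prod_const, Finset.card_univ, Fintype.card_fin]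
    at key
  refine (mul_le_mul_of_nonneg_right ?_ ?_).trans key
  · push_cast
    calc 1 / (n : ℝ) ^ (3 * d) = ((n : ℝ)⁻¹ ^ d) ^ 2 / (n : ℝ) ^ d := by
          rw [show 3 * d = d + d + d by ring, pow_add, pow_add, inv_pow]
          field_simp
      _ ≤ (Real.sin (midAngle n 0) ^ d) ^ 2 / (n : ℝ) ^ d := by
          gcongr
          exact inv_le_sin_midAngle_zero hn
  · exact pow_nonneg (le_min p.2.1 (sub_nonneg.2 p.2.2)) _

end LowerBounds

section Asymptotics

variable {d : ℕ} {E : ℝ}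

theorem exists_length_scale (hd : 1 ≤ d) (hE : 0 < E) (hE4 : E ≤ 4 * d) :
    ∃ n : ℕ, 2 ≤ n ∧ (n : ℝ) ≤ 8 * d * E ^ (-(1 : ℝ) / 2) ∧ d * (Real.pi / n) ^ 2 ≤ E := by
  have hd' : (1 : ℝ) ≤ d := by exact_mod_cast hd
  obtain ⟨r, hr⟩ : ∃ r, r = E ^ (-(1 : ℝ) / 2) := ⟨_, rfl⟩
  have hr0 : 0 < r := hr ▸ Real.rpow_pos_of_pos hE _
  have hr2 : r ^ 2 * E = 1 := by
    rw [hr, ← Real.rpow_natCast, ← Real.rpow_mul hE.le]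
    norm_num [Real.rpow_neg_one, hE.ne']
  have hdr : 1 ≤ 2 * d * r := by
    rw [← one_le_sq_iff₀ (by positivity)]
    nlinarith [mul_le_mul_of_nonneg_left hE4 (sq_nonneg r)]
  have hceil : 4 * d * r ≤ ⌈4 * d * r⌉₊ := Nat.le_ceil _
  have hceil' : (⌈4 * d * r⌉₊ : ℝ) < 4 * d * r + 1 := Nat.ceil_lt_add_one (by positivity)
  have hceil0 : 0 < ⌈4 * d * r⌉₊ := Nat.ceil_pos.2 (by positivity)
  refine ⟨⌈4 * d * r⌉₊ + 1, by omega, ?_, ?_⟩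
  · rw [← hr]
    push_cast
    linarith
  · calc d * (Real.pi / (⌈4 * d * r⌉₊ + 1 : ℕ)) ^ 2 ≤ d * (4 / (4 * d * r)) ^ 2 := by
          push_cast
          gcongr
          · exact Real.pi_lt_four.le
          · linarith
      _ = E / d := by
          field_simp
          linarith
      _ ≤ E := div_le_self hE.le hd'

theorem exp_neg_le_one_div_pow_mul_pow {q : ℝ} (hq : 0 < q) {n : ℕ} (hn : n ≠ 0) (k m : ℕ) :
    Real.exp (-(k * n + -Real.log q * m)) ≤ 1 / (n : ℝ) ^ k * q ^ m := by
  have hn' : (0 : ℝ) < n := by exact_mod_cast Nat.pos_of_ne_zero hn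
  have hexp : Real.exp (-n) ≤ 1 / n := by
    rw [Real.exp_neg, ← one_div]
    exact one_div_le_one_div_of_le hn' (by linarith [Real.add_one_le_exp (n : ℝ)])
  have hpow : Real.exp (-(k * n)) = Real.exp (-n) ^ k := by rw [← Real.exp_nat_mul, mul_neg]
  have hqm : Real.exp (-(-Real.log q * m)) = q ^ m := by
    rw [neg_mul, neg_neg, mul_comm, Real.exp_nat_mul, Real.exp_log hq]
  rw [neg_add, Real.exp_add, hqm, hpow, ← one_div_pow]
  gcongr

variable {p : unitInterval}

theorem min_pos_of_mem_Ioo (hp : p ∈ Set.Ioo 0 1) : 0 < min (p : ℝ) (1 - p) :=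
  lt_min hp.1 (sub_pos.2 hp.2)

theorem neg_log_min_nonneg (p : unitInterval) : 0 ≤ -Real.log (min (p : ℝ) (1 - p)) :=
  neg_nonneg.2 (Real.log_nonpos (le_min p.2.1 (sub_nonneg.2 p.2.2)) ((min_le_left _ _).trans p.2.2))

theorem exists_exp_le_ids_neumann_sub (hd : 1 ≤ d) (hp : p ∈ Set.Ioo 0 1) :
    ∃ α : ℝ, 0 < α ∧ ∀ E : ℝ, 0 < E → E ≤ 4 * d →
      Real.exp (-α * E ^ (-(1 : ℝ) / 2)) ≤ ids d p .neumann E - ids d p .neumann 0 := by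
  have hd' : (1 : ℝ) ≤ d := by exact_mod_cast hd
  have hκ := neg_log_min_nonneg p
  set κ := -Real.log (min (p : ℝ) (1 - p))
  refine ⟨(2 + 2 * d * κ) * (8 * d), by positivity, fun E hE hE4 => ?_⟩
  obtain ⟨n, hn, hnE, hEn⟩ := exists_length_scale hd hE hE4
  have hEn' : (Real.pi / n) ^ 2 ≤ E := (le_mul_of_one_le_left (sq_nonneg _) hd').trans hEn
  calc Real.exp (-((2 + 2 * d * κ) * (8 * d)) * E ^ (-(1 : ℝ) / 2))
      ≤ Real.exp (-((2 : ℕ) * n + κ * (2 * d * n : ℕ))) := by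
        rw [Real.exp_le_exp]
        push_cast
        linarith [mul_le_mul_of_nonneg_left hnE (show 0 ≤ 2 + 2 * d * κ by positivity)]
    _ ≤ 1 / (n : ℝ) ^ 2 * min (p : ℝ) (1 - p) ^ (2 * d * n) :=
        exp_neg_le_one_div_pow_mul_pow (min_pos_of_mem_Ioo hp) (by omega) _ _
    _ ≤ ids d p .neumann E - ids d p .neumann 0 :=
        one_div_sq_mul_min_pow_le_ids_neumann_sub hd p hn hEn'

theorem exists_exp_le_ids_dirichlet (hd : 1 ≤ d) (hp : p ∈ Set.Ioo 0 1) :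
    ∃ α : ℝ, 0 < α ∧ ∀ E : ℝ, 0 < E → E ≤ 4 * d →
      Real.exp (-α * E ^ (-(d : ℝ) / 2)) ≤ ids d p .dirichlet E := by
  have hκ := neg_log_min_nonneg p
  set κ := -Real.log (min (p : ℝ) (1 - p))
  refine ⟨(3 * d + 2 * d * κ) * (8 * d) ^ d, by positivity, fun E hE hE4 => ?_⟩
  obtain ⟨n, hn, hnE, hEn⟩ := exists_length_scale hd hE hE4
  have hrpow : (E ^ (-(1 : ℝ) / 2)) ^ d = E ^ (-(d : ℝ) / 2) := by
    rw [← Real.rpow_natCast, ← Real.rpow_mul hE.le]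
    congr 1
    ring
  have hnd : (n : ℝ) ≤ (n : ℝ) ^ d := le_self_pow₀ (by exact_mod_cast (by omega : 1 ≤ n)) (by omega)
  have hndE : (n : ℝ) ^ d ≤ (8 * d) ^ d * E ^ (-(d : ℝ) / 2) := by
    rw [← hrpow, ← mul_pow]
    gcongr
  calc Real.exp (-((3 * d + 2 * d * κ) * (8 * d) ^ d) * E ^ (-(d : ℝ) / 2))
      ≤ Real.exp (-((3 * d : ℕ) * n + κ * (2 * d * n ^ d : ℕ))) := by
        rw [Real.exp_le_exp]
        push_cast
        linarith [mul_le_mul_of_nonneg_left hnd (show 0 ≤ 3 * (d : ℝ) by positivity),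
          mul_le_mul_of_nonneg_left hndE (show 0 ≤ 3 * d + 2 * d * κ by positivity)]
    _ ≤ 1 / (n : ℝ) ^ (3 * d) * min (p : ℝ) (1 - p) ^ (2 * d * n ^ d) :=
        exp_neg_le_one_div_pow_mul_pow (min_pos_of_mem_Ioo hp) (by omega) _ _
    _ ≤ ids d p .dirichlet E := one_div_pow_mul_min_pow_le_ids_dirichlet p (by omega) hEn

end Asymptotics

end BondPercolation

end

theorem mainTheorem3 (d : ℕ) (hd : 1 ≤ d) (p : unitInterval) (hp0 : 0 < p) (hp1 : p < 1) :
    ∃ αN αD : ℝ, 0 < αN ∧ 0 < αD ∧ ∀ E : ℝ, 0 < E → E ≤ 4 * d →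
      Real.exp (-αN * E ^ (-(1 : ℝ) / 2))
          ≤ BondPercolation.ids d p .neumann E - BondPercolation.ids d p .neumann 0 ∧
      BondPercolation.ids d p .dirichlet E ≤ BondPercolation.ids d p .pseudoDirichlet E ∧
      Real.exp (-αD * E ^ (-(d : ℝ) / 2)) ≤ BondPercolation.ids d p .dirichlet E := by
  obtain ⟨αN, hαN, hN⟩ := BondPercolation.exists_exp_le_ids_neumann_sub hd ⟨hp0, hp1⟩
  obtain ⟨αD, hαD, hD⟩ := BondPercolation.exists_exp_le_ids_dirichlet hd ⟨hp0, hp1⟩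
  refine ⟨αN, αD, hαN, hαD, fun E hE hE4 => ⟨hN E hE hE4, ?_, hD E hE hE4⟩⟩
  exact BondPercolation.ids_le_ids p (by norm_num [BondPercolation.reflectionSign]) E
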